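/- Let $H$ be a complex Hilbert space with $\dim H\ge 3$. A bounded linear operator $U$ on $H$ is a partial isometry if there is a closed subspace $I_U$ of $H$ (its initial space) such that $U$ acts as an isometry on $I_U$ and is zero on $I_U^\perp$; the range $F_U$ of $U$ is its final space. Let $PI(H)$ be the set of all partial isometries on $H$. For $P,Q\in PI(H)$ write $P\le Q$ if $I_P\subset I_Q$, $F_P\subset F_Q$ and $P|_{I_P}=Q|_{I_P}$, and call $P$ orthogonal to $Q$ if $P^*Q=PQ^*=0$. A unitary (respectively antiunitary) operator on $H$ is a linear (respectively conjugate-linear) norm-preserving bijection of $H$. Let $\phi:PI(H)\to PI(H)$ be a bijection that preserves the partial ordering and the orthogonality in both directions, that is, for all $P,Q\in PI(H)$, $P\le Q$ if and only if $\phi(P)\le\phi(Q)$, and $P$ is orthogonal to $Q$ if and only if $\phi(P)$ is orthogonal to $\phi(Q)$. Suppose that $\phi$ is continuous, with respect to the operator norm, at some element of $PI(H)$ different from $0$. Then at least one of the following holds: (i) there exist unitaries $U,V$ on $H$ such that $\phi(R)=URV$ for all $R\in PI(H)$; (ii) there exist antiunitaries $U,V$ on $H$ such that $\phi(R)=URV$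 for all $R\in PI(H)$; (iii) there exist unitaries $U,V$ on $H$ such that $\phi(R)=UR^*V$ for all $R\in PI(H)$; (iv) there exist antiunitaries $U,V$ on $H$ such that $\phi(R)=UR^*V$ for all $R\in PI(H)$. -/

import Mathlib

open ContinuousLinearMap

section PartialIsometries

variable {H : Type*} [NormedAddCommGroup H] [InnerProductSpace ℂ H]

/-- A bounded operator `U` is a partial isometry if there is a closed subspace on which `U` acts as
an isometry and such that `U` is zero on its orthogonal complement. -/
def IsPartialIsometry (U : H →L[ℂ] H) : Prop :=
  ∃ M : Submodule ℂ H, IsClosed (M : Set H) ∧ (∀ x ∈ M, ‖U x‖ = ‖x‖) ∧ ∀ x ∈ Mᗮ, U x = 0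

/-- The initial space of a partial isometry, i.e. the orthogonal complement of its kernel. By
`eq_initialSpace` below it is the only subspace that can occur in `IsPartialIsometry`. -/
noncomputable def initialSpace (U : H →L[ℂ] H) : Submodule ℂ H :=
  (LinearMap.ker (U : H →ₗ[ℂ] H))ᗮ

/-- The final space of a partial isometry, i.e. its range. -/
def finalSpace (U : H →L[ℂ] H) : Submodule ℂ H :=
  LinearMap.range (U : H →ₗ[ℂ] H)

theorem eq_initialSpace [CompleteSpace H] (U : H →L[ℂ] H) (M : Submodule ℂ H)
    (hM : IsClosed (M : Set H)) (hiso : ∀ x ∈ M, ‖U x‖ = ‖x‖) (hzero : ∀ x ∈ Mᗮ, U x = 0) :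
    M = initialSpace U := by
  have : CompleteSpace M := hM.completeSpace_coe
  have hker : LinearMap.ker (U : H →ₗ[ℂ] H) = Mᗮ := by
    apply le_antisymm
    · intro x hx
      have hx0 : U x = 0 := hx
      obtain ⟨m, hm, n, hn, rfl⟩ := M.exists_add_mem_mem_orthogonal x
      have h0 : U m = 0 := by simpa [hzero n hn] using hx0
      have h1 := hiso m hm
      rw [h0, norm_zero] at h1
      have h2 : m = 0 := norm_eq_zero.mp h1.symm
      simpa [h2] using hn
    · intro x hx
      exact hzero x hx
  unfold initialSpace
  rw [hker, Submodule.orthogonal_orthogonal]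

variable (H) in
/-- The set of all partial isometries on `H`, with the topology of the operator norm. -/
abbrev PI : Type _ := {U : H →L[ℂ] H // IsPartialIsometry U}

/-- The partial ordering of partial isometries: inclusion of the initial spaces and of the final
spaces, and agreement on the smaller initial space. -/
def PILe (P Q : PI H) : Prop :=
  initialSpace P.1 ≤ initialSpace Q.1 ∧ finalSpace P.1 ≤ finalSpace Q.1 ∧
    ∀ x ∈ initialSpace P.1, P.1 x = Q.1 x

/-- Orthogonality of partial isometries: `P* Q = 0` and `P Q* = 0`. -/
def PIOrthogonal [CompleteSpace H] (P Q : PI H) : Prop :=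
  adjoint P.1 ∘L Q.1 = 0 ∧ P.1 ∘L adjoint Q.1 = 0

end PartialIsometries

/-! ### Partial isometries, their order, and the rank-one atoms. -/

section Basics

open InnerProductSpace

open scoped InnerProductSpace

variable {H : Type*} [NormedAddCommGroup H] [InnerProductSpace ℂ H] [CompleteSpace H]

/-! The minimal nonzero partial isometries are the atoms, the rank-one maps `atom x y` sending `y`
to `x`, and `atom x y ≤ Q` says exactly that `Q y = x`. So `φ` permutes the atoms, and through the
order its values on atoms control it everywhere.

Orthogonality of atoms is orthogonality in both coordinates. Double orthogonal complements are
spans, so orthogonality alone detects when two atoms share a line in some coordinate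
(`pairColl_iff`). A map of a grid respecting this relation acts coordinatewise, possibly after an
exchange of coordinates (`RookMap.product_or_swap`); precomposing `φ` with the adjoint undoes the
exchange. Hence `φ (atom x y)` is a unimodular multiple of `atom (u x) (v y)`.

If `⟪x, x'⟫ = ⟪y, y'⟫`, some partial isometry carries `y, y'` to `x, x'` (the degenerate case is
separate), and its image under `φ` shows `‖⟪u x, u x'⟫‖ = ‖⟪v y, v y'⟫‖`. So `‖⟪u x, u x'⟫‖²` is a
function `k` of `‖⟪x, x'⟫‖²`. As `u` preserves orthogonality, Parseval for an orthonormal triple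
gives `k r + k s + k t = 1` whenever `r + s + t = 1`, which forces `k` to be the identity on `[0,
1]`. Wigner's theorem now yields `u` and `v`, up to phases, as linear or conjugate-linear isometries
`L` and `M`. Rank-two partial isometries show that the remaining phase is constant and that `L` and
`M` are of the same type (`coeff_const`); `apply_of_map_atom` passes from atoms to all partial
isometries. -/

theorem adjoint_apply_mem_initialSpace (U : H →L[ℂ] H) (x : H) :
    adjoint U x ∈ initialSpace U := by
  intro y hy
  have hy' : U y = 0 := hy
  rw [adjoint_inner_right, hy', inner_zero_left]

/-- By polarization `U` preserves inner products on `M`, so `U* U` is the identity on `M`. With the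
converse below, `U U* U = U` becomes the working form of the definition. -/
theorem IsPartialIsometry.apply_adjoint_apply {U : H →L[ℂ] H} (hU : IsPartialIsometry U) (x : H) :
    U (adjoint U (U x)) = U x := by
  obtain ⟨M, hM, hiso, hzero⟩ := hU
  have : CompleteSpace M := hM.completeSpace_coe
  let f : M →ₗᵢ[ℂ] H := ⟨(U : H →ₗ[ℂ] H).comp M.subtype, fun x => hiso x x.2⟩
  have hf : ∀ a ∈ M, ∀ b ∈ M, ⟪U a, U b⟫_ℂ = ⟪a, b⟫_ℂ := fun a ha b hb =>
    f.inner_map_map ⟨a, ha⟩ ⟨b, hb⟩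
  have key : ∀ m ∈ M, adjoint U (U m) = m := by
    intro m hm
    refine ext_inner_right ℂ fun y => ?_
    obtain ⟨a, ha, b, hb, rfl⟩ := M.exists_add_mem_mem_orthogonal y
    rw [adjoint_inner_left, map_add, hzero b hb, add_zero, hf m hm a ha, inner_add_right,
      hb m hm, add_zero]
  obtain ⟨a, ha, b, hb, rfl⟩ := M.exists_add_mem_mem_orthogonal x
  rw [map_add, hzero b hb, add_zero, key a ha]

theorem mem_orthogonal_initialSpace_iff {U : H →L[ℂ] H} {x : H} :
    x ∈ (initialSpace U)ᗮ ↔ U x = 0 := by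
  have : IsClosed (LinearMap.ker (U : H →ₗ[ℂ] H) : Set H) := U.isClosed_ker
  have : CompleteSpace (LinearMap.ker (U : H →ₗ[ℂ] H)) := this.completeSpace_coe
  rw [initialSpace, Submodule.orthogonal_orthogonal, LinearMap.mem_ker]
  rfl

theorem isPartialIsometry_of_apply_adjoint_apply {U : H →L[ℂ] H}
    (h : ∀ x, U (adjoint U (U x)) = U x) : IsPartialIsometry U := by
  refine ⟨initialSpace U, Submodule.isClosed_orthogonal _, fun x hx => ?_,
    fun x hx => mem_orthogonal_initialSpace_iff.1 hx⟩
  have h1 : x - adjoint U (U x) ∈ LinearMap.ker (U : H →ₗ[ℂ] H) := by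
    simp [h]
  have h2 := hx _ h1
  rw [inner_sub_left, adjoint_inner_left, sub_eq_zero, inner_self_eq_norm_sq_to_K,
    inner_self_eq_norm_sq_to_K] at h2
  have h3 : ‖x‖ ^ 2 = ‖U x‖ ^ 2 := by exact_mod_cast h2
  exact ((sq_eq_sq₀ (norm_nonneg _) (norm_nonneg _)).1 h3).symm

theorem IsPartialIsometry.mem_initialSpace_iff {U : H →L[ℂ] H} (hU : IsPartialIsometry U)
    {x : H} : x ∈ initialSpace U ↔ adjoint U (U x) = x := by
  constructor
  · intro hx
    have h1 : x - adjoint U (U x) ∈ LinearMap.ker (U : H →ₗ[ℂ] H) := by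
      simp [hU.apply_adjoint_apply]
    have h2 : x - adjoint U (U x) ∈ initialSpace U :=
      sub_mem hx (adjoint_apply_mem_initialSpace U _)
    have h3 := h2 _ h1
    rw [inner_self_eq_zero, sub_eq_zero] at h3
    exact h3.symm
  · intro h
    rw [← h]
    exact adjoint_apply_mem_initialSpace U _

theorem IsPartialIsometry.norm_apply {U : H →L[ℂ] H} (hU : IsPartialIsometry U) {x : H}
    (hx : x ∈ initialSpace U) : ‖U x‖ = ‖x‖ := by
  have h : ⟪U x, U x⟫_ℂ = ⟪x, x⟫_ℂ := by
    rw [← adjoint_inner_left, hU.mem_initialSpace_iff.1 hx]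
  rw [inner_self_eq_norm_sq_to_K, inner_self_eq_norm_sq_to_K] at h
  have h3 : ‖U x‖ ^ 2 = ‖x‖ ^ 2 := by exact_mod_cast h
  exact (sq_eq_sq₀ (norm_nonneg _) (norm_nonneg _)).1 h3

/-- Expanding `‖U* U x - x‖²` gives four terms `±‖x‖²` that cancel. -/
theorem IsPartialIsometry.mem_initialSpace_of_norm {U : H →L[ℂ] H} (hU : IsPartialIsometry U)
    {x : H} (hx : ‖U x‖ = ‖x‖) : x ∈ initialSpace U := by
  rw [hU.mem_initialSpace_iff]
  have h1 : ⟪adjoint U (U x), x⟫_ℂ = (‖x‖ : ℂ) ^ 2 := by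
    rw [adjoint_inner_left, inner_self_eq_norm_sq_to_K, hx]; rfl
  have h2 : ⟪adjoint U (U x), adjoint U (U x)⟫_ℂ = (‖x‖ : ℂ) ^ 2 := by
    rw [adjoint_inner_left, hU.apply_adjoint_apply, inner_self_eq_norm_sq_to_K, hx]; rfl
  have h3 : ⟪x, adjoint U (U x)⟫_ℂ = (‖x‖ : ℂ) ^ 2 := by
    rw [adjoint_inner_right, inner_self_eq_norm_sq_to_K, hx]; rfl
  have h4 : ⟪x, x⟫_ℂ = (‖x‖ : ℂ) ^ 2 := inner_self_eq_norm_sq_to_K x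
  rw [← sub_eq_zero, ← inner_self_eq_zero (𝕜 := ℂ), inner_sub_left, inner_sub_right,
    inner_sub_right, h1, h2, h3, h4]
  ring

/-- Only one of the two vectors has to lie in the initial space, because `U* U` fixes it and can be
moved across the inner product. -/
theorem IsPartialIsometry.inner_apply_apply {U : H →L[ℂ] H} (hU : IsPartialIsometry U) {x : H}
    (hx : ‖U x‖ = ‖x‖) (y : H) : ⟪U x, U y⟫_ℂ = ⟪x, y⟫_ℂ := by
  rw [← adjoint_inner_left, hU.mem_initialSpace_iff.1 (hU.mem_initialSpace_of_norm hx)]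

theorem IsPartialIsometry.adjoint {U : H →L[ℂ] H} (hU : IsPartialIsometry U) :
    IsPartialIsometry (adjoint U) := by
  refine isPartialIsometry_of_apply_adjoint_apply fun x => ?_
  refine ext_inner_right ℂ fun y => ?_
  simp only [adjoint_inner_left, adjoint_adjoint]
  rw [← adjoint_inner_right, adjoint_inner_left, hU.apply_adjoint_apply]

/-- Agreement forces both inclusions: `Q` is then norm-preserving on the initial space of `P`, and
`P z = Q (P* P z)`. -/
theorem piLe_iff {P Q : PI H} : PILe P Q ↔ ∀ x ∈ initialSpace P.1, P.1 x = Q.1 x := by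
  refine ⟨fun h => h.2.2, fun h => ⟨fun x hx => ?_, ?_, h⟩⟩
  · exact Q.2.mem_initialSpace_of_norm (by rw [← h x hx, P.2.norm_apply hx])
  · rintro _ ⟨z, rfl⟩
    refine ⟨ContinuousLinearMap.adjoint P.1 (P.1 z), ?_⟩
    have := h _ (adjoint_apply_mem_initialSpace P.1 (P.1 z))
    rw [P.2.apply_adjoint_apply] at this
    exact this.symm

theorem PILe.antisymm {P Q : PI H} (h : PILe P Q) (h' : PILe Q P) : P = Q := by
  have hI : initialSpace P.1 = initialSpace Q.1 := le_antisymm h.1 h'.1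
  have : CompleteSpace (initialSpace P.1) :=
    (Submodule.isClosed_orthogonal _).completeSpace_coe
  refine Subtype.ext (ContinuousLinearMap.ext fun x => ?_)
  obtain ⟨a, ha, b, hb, rfl⟩ := (initialSpace P.1).exists_add_mem_mem_orthogonal x
  have hb' := hI ▸ hb
  rw [mem_orthogonal_initialSpace_iff] at hb hb'
  rw [map_add, map_add, h.2.2 a ha, hb, hb']

/-- The zero operator as a partial isometry. -/
def zeroPI : PI H := ⟨0, isPartialIsometry_of_apply_adjoint_apply fun x => by simp⟩

theorem zeroPI_le (P : PI H) : PILe zeroPI P := by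
  rw [piLe_iff]
  intro x hx
  have : x = 0 := by
    have := (zeroPI : PI H).2.mem_initialSpace_iff.1 hx
    simpa [zeroPI] using this.symm
  simp [this]

theorem exists_unit_mem_initialSpace {P : PI H} (h : P ≠ zeroPI) :
    ∃ y ∈ initialSpace P.1, ‖y‖ = 1 := by
  by_contra! hc
  apply h
  refine Subtype.ext (ContinuousLinearMap.ext fun x => ?_)
  by_contra hx
  set w := ContinuousLinearMap.adjoint P.1 (P.1 x) with hw
  have hw0 : w ≠ 0 := by
    intro h0
    apply hx
    rw [← P.2.apply_adjoint_apply x, ← hw, h0, map_zero]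
    rfl
  refine hc ((‖w‖⁻¹ : ℂ) • w) (Submodule.smul_mem _ _ (adjoint_apply_mem_initialSpace P.1 _)) ?_
  rw [norm_smul, norm_inv, Complex.norm_real, norm_norm, inv_mul_cancel₀ (norm_ne_zero_iff.2 hw0)]

/-- The adjoint of a partial isometry. -/
noncomputable def adjointPI (P : PI H) : PI H := ⟨adjoint P.1, P.2.adjoint⟩

@[simp]
theorem adjointPI_adjointPI (P : PI H) : adjointPI (adjointPI P) = P :=
  Subtype.ext (adjoint_adjoint P.1)

theorem PILe.adjointPI {P Q : PI H} (h : PILe P Q) : PILe (adjointPI P) (adjointPI Q) := by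
  rw [piLe_iff]
  intro z hz
  have hz' := (_root_.adjointPI P).2.mem_initialSpace_iff.1 hz
  change adjoint (adjoint P.1) (adjoint P.1 z) = z at hz'
  change adjoint P.1 z = adjoint Q.1 z
  rw [adjoint_adjoint] at hz'
  have h1 := adjoint_apply_mem_initialSpace P.1 z
  have h2 := Q.2.mem_initialSpace_iff.1 (h.1 h1)
  rw [← h.2.2 _ h1, hz'] at h2
  exact h2.symm

theorem adjointPI_le_iff {P Q : PI H} : PILe (adjointPI P) (adjointPI Q) ↔ PILe P Q :=
  ⟨fun h => by simpa using h.adjointPI, fun h => h.adjointPI⟩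

theorem adjointPI_orthogonal_iff {P Q : PI H} :
    PIOrthogonal (adjointPI P) (adjointPI Q) ↔ PIOrthogonal P Q := by
  simp only [PIOrthogonal, adjointPI, adjoint_adjoint]
  exact and_comm

/-- The rank-one partial isometry sending the unit vector `y` to the unit vector `x`. -/
noncomputable def atom (x y : Metric.sphere (0 : H) 1) : PI H :=
  ⟨rankOne ℂ (x : H) (y : H), isPartialIsometry_of_apply_adjoint_apply fun z => by
    simp⟩

theorem atom_apply (x y : Metric.sphere (0 : H) 1) (z : H) :
    (atom x y).1 z = ⟪(y : H), z⟫_ℂ • (x : H) := rfl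

@[simp]
theorem atom_apply_self (x y : Metric.sphere (0 : H) 1) : (atom x y).1 y = x := by
  simp [atom_apply]

theorem mem_initialSpace_atom {x y : Metric.sphere (0 : H) 1} {z : H} :
    z ∈ initialSpace (atom x y).1 ↔ ⟪(y : H), z⟫_ℂ • (y : H) = z := by
  rw [(atom x y).2.mem_initialSpace_iff]
  simp [atom]

/-- This is how the order sees values of operators; all information about `φ` away from atoms is
extracted through it. -/
theorem atom_le_iff {x y : Metric.sphere (0 : H) 1} {Q : PI H} :
    PILe (atom x y) Q ↔ Q.1 y = x := by
  rw [piLe_iff]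
  constructor
  · intro h
    rw [← h y (mem_initialSpace_atom.2 (by simp)), atom_apply_self]
  · intro h z hz
    rw [mem_initialSpace_atom] at hz
    rw [← hz, map_smul, map_smul, h, atom_apply_self]

theorem atom_ne_zero (x y : Metric.sphere (0 : H) 1) : atom x y ≠ zeroPI := by
  intro h
  have h1 := atom_apply_self x y
  rw [h] at h1
  have h2 : (0 : H) = x := h1
  have := norm_eq_of_mem_sphere x
  rw [← h2] at this
  simp at this

/-- Minimality of atoms: a nonzero initial space inside the line of `y` contains `y`. -/
theorem eq_zero_or_eq_of_le_atom {x y : Metric.sphere (0 : H) 1} {Q : PI H}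
    (h : PILe Q (atom x y)) : Q = zeroPI ∨ Q = atom x y := by
  by_cases h0 : Q = zeroPI
  · exact Or.inl h0
  right
  obtain ⟨z, hz, hz1⟩ := exists_unit_mem_initialSpace h0
  refine h.antisymm ?_
  rw [atom_le_iff]
  have h1 := h.1 hz
  rw [mem_initialSpace_atom] at h1
  have hc : ⟪(y : H), z⟫_ℂ ≠ 0 := by
    intro hc
    rw [hc, zero_smul] at h1
    rw [← h1, norm_zero] at hz1
    exact zero_ne_one hz1
  have hy : (y : H) ∈ initialSpace Q.1 := by
    rw [← h1] at hz
    exact (Submodule.smul_mem_iff _ hc).1 hz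
  rw [h.2.2 _ hy, atom_apply_self]

/-- The image of a unit vector of the initial space, as a unit vector. -/
def PI.applyUnit (P : PI H) (y : Metric.sphere (0 : H) 1) (hy : (y : H) ∈ initialSpace P.1) :
    Metric.sphere (0 : H) 1 :=
  ⟨P.1 y, by simp [P.2.norm_apply hy]⟩

theorem atom_applyUnit_le (P : PI H) (y : Metric.sphere (0 : H) 1)
    (hy : (y : H) ∈ initialSpace P.1) : PILe (atom (P.applyUnit y hy) y) P :=
  atom_le_iff.2 rfl

theorem mem_initialSpace_of_atom_le {P : PI H} {x y : Metric.sphere (0 : H) 1}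
    (h : PILe (atom x y) P) : (y : H) ∈ initialSpace P.1 :=
  P.2.mem_initialSpace_of_norm (by rw [atom_le_iff.1 h]; simp)

theorem exists_atom_le {P : PI H} (h : P ≠ zeroPI) : ∃ x y, PILe (atom x y) P := by
  obtain ⟨z, hz, hz1⟩ := exists_unit_mem_initialSpace h
  exact ⟨_, ⟨z, by simpa using hz1⟩, atom_applyUnit_le P ⟨z, by simpa using hz1⟩ hz⟩

theorem atom_orthogonal_iff {x y x' y' : Metric.sphere (0 : H) 1} :
    PIOrthogonal (atom x y) (atom x' y') ↔ ⟪(x : H), x'⟫_ℂ = 0 ∧ ⟪(y : H), y'⟫_ℂ = 0 := by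
  have hx : (x : H) ≠ 0 := ne_zero_of_mem_unit_sphere x
  have hx' : (x' : H) ≠ 0 := ne_zero_of_mem_unit_sphere x'
  have hy : (y : H) ≠ 0 := ne_zero_of_mem_unit_sphere y
  have hy' : (y' : H) ≠ 0 := ne_zero_of_mem_unit_sphere y'
  simp only [PIOrthogonal, atom, adjoint_rankOne, rankOne_comp_rankOne]
  simp [hx, hx', hy, hy']

theorem isPartialIsometry_rankOne_add_rankOne {x₁ x₂ y₁ y₂ : H} (hx₁ : ‖x₁‖ = 1) (hx₂ : ‖x₂‖ = 1)
    (hy₁ : ‖y₁‖ = 1) (hy₂ : ‖y₂‖ = 1) (hx : ⟪x₁, x₂⟫_ℂ = 0) (hy : ⟪y₁, y₂⟫_ℂ = 0) :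
    IsPartialIsometry (rankOne ℂ x₁ y₁ + rankOne ℂ x₂ y₂) := by
  have hx' := inner_eq_zero_symm.1 hx
  have hy' := inner_eq_zero_symm.1 hy
  refine isPartialIsometry_of_apply_adjoint_apply fun z => ?_
  simp [inner_smul_right, inner_add_right, hx, hy, hx', hy', hx₁, hx₂, hy₁, hy₂]

end Basics

/-! ### Maps of a grid that respect sharing a coordinate. -/

section Rook

variable {X : Type*}

/-- Points of the product grid sharing a coordinate are sent to points sharing a coordinate. -/
structure RookMap (F : X → X → X × X) : Prop where
  inj : ∀ x y x' y', F x y = F x' y' → x = x' ∧ y = y'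
  coll : ∀ x y x' y', (x = x' ∨ y = y') ↔ ((F x y).1 = (F x' y').1 ∨ (F x y).2 = (F x' y').2)

theorem RookMap.swap {F : X → X → X × X} (hF : RookMap F) :
    RookMap (fun x y => (F x y).swap) where
  inj x y x' y' h := hF.inj x y x' y' (Prod.swap_injective h)
  coll x y x' y' := by
    rw [hF.coll]
    exact or_comm

/-- Any two points of the image of a row share a coordinate. If two of them differ in the first,
they agree in the second, and every further point, having to meet both, lies on that same line. -/
theorem RookMap.row {F : X → X → X × X} (hF : RookMap F) (x : X) :
    (∀ y y', (F x y).1 = (F x y').1) ∨ (∀ y y', (F x y).2 = (F x y').2) := by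
  by_contra! h
  obtain ⟨⟨y₁, y₂, h1⟩, y₃, y₄, h2⟩ := h
  have c : ∀ y y', (F x y).1 = (F x y').1 ∨ (F x y).2 = (F x y').2 := fun y y' =>
    (hF.coll x y x y').1 (Or.inl rfl)
  have key : ∀ y, (F x y).2 = (F x y₁).2 := by
    intro y
    have := c y y₁
    have := c y y₂
    have := c y₁ y₂
    grind
  exact h2 ((key y₃).trans (key y₄).symm)

/-- All rows have the same type. Otherwise row `x₀` lies in a line `first = A` and row `x` in a line
`second = B`; for each `y` the two image points share a coordinate, so one of them is the crossing
point `(A, B)`. By injectivity this happens for at most two values of `y`, against the three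
elements `a`, `b`, `c`. -/
theorem RookMap.eq_iff_of_row {F : X → X → X × X} (hF : RookMap F) {a b c : X} (hab : a ≠ b)
    (hac : a ≠ c) (hbc : b ≠ c) {x₀ : X} (hx₀ : ∀ y y', (F x₀ y).1 = (F x₀ y').1)
    (x y x' y' : X) :
    (x = x' ↔ (F x y).1 = (F x' y').1) ∧ (y = y' ↔ (F x y).2 = (F x' y').2) := by
  have row : ∀ x y y', (F x y).1 = (F x y').1 := by
    intro x
    by_contra hx
    have hv := (hF.row x).resolve_left hx
    have hxx : x₀ ≠ x := fun h => hx (h ▸ hx₀)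
    have e1 : ∀ y y', (F x₀ y).2 = (F x a).2 → (F x₀ y').2 = (F x a).2 → y = y' :=
      fun y y' h h' => (hF.inj x₀ y x₀ y' (Prod.ext (hx₀ _ _) (h.trans h'.symm))).2
    have e2 : ∀ y y', (F x y).1 = (F x₀ a).1 → (F x y').1 = (F x₀ a).1 → y = y' :=
      fun y y' h h' => (hF.inj x y x y' (Prod.ext (h.trans h'.symm) (hv _ _))).2
    have e3 : ∀ y, (F x y).1 = (F x₀ a).1 ∨ (F x₀ y).2 = (F x a).2 := by
      intro y
      rcases (hF.coll x₀ y x y).1 (Or.inr rfl) with h | h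
      · exact Or.inl (h.symm.trans (hx₀ _ _))
      · exact Or.inr (h.trans (hv _ _))
    have ha := e3 a
    have hb := e3 b
    have hc := e3 c
    clear hx hv hx₀ e3
    grind
  have h1 : ∀ x y x' y', x = x' ↔ (F x y).1 = (F x' y').1 := by
    intro x y x' y'
    refine ⟨fun h => h ▸ row x y y', fun h => ?_⟩
    -- Sliding along the rows to distinct columns rules out the alternative of a common column.
    have h2 : (F x a).1 = (F x' b).1 := (row x a y).trans (h.trans (row x' y' b))
    exact ((hF.coll x a x' b).2 (Or.inl h2)).resolve_right hab
  refine ⟨h1 x y x' y', fun h => ?_, fun h => ?_⟩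
  · subst h
    by_cases hxx : x = x'
    · rw [hxx]
    · exact ((hF.coll x y x' y).1 (Or.inr rfl)).resolve_left fun h => hxx ((h1 _ _ _ _).2 h)
  · rcases (hF.coll x y x' y').2 (Or.inr h) with hxx | hyy
    · subst hxx
      exact (hF.inj x y x y' (Prod.ext (row x y y') h)).2
    · exact hyy

theorem RookMap.product_or_swap {F : X → X → X × X} (hF : RookMap F) {a b c : X} (hab : a ≠ b)
    (hac : a ≠ c) (hbc : b ≠ c) :
    (∀ x y x' y', (x = x' ↔ (F x y).1 = (F x' y').1) ∧ (y = y' ↔ (F x y).2 = (F x' y').2)) ∨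
    (∀ x y x' y', (x = x' ↔ (F x y).2 = (F x' y').2) ∧ (y = y' ↔ (F x y).1 = (F x' y').1)) := by
  rcases hF.row a with h | h
  · exact Or.inl fun x y x' y' => hF.eq_iff_of_row hab hac hbc h x y x' y'
  · exact Or.inr fun x y x' y' => hF.swap.eq_iff_of_row hab hac hbc h x y x' y'

end Rook

/-! ### Recovering lines from orthogonality of pairs of unit vectors. -/

section Lines

open scoped InnerProductSpace

variable {H : Type*} [NormedAddCommGroup H] [InnerProductSpace ℂ H]

/-- Two vectors span at most a plane, so dimension three leaves room. With zero arguments it merely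
supplies unit vectors. -/
theorem exists_unit_orthogonal (hdim : 3 ≤ Module.rank ℂ H) (x y : H) :
    ∃ z : Metric.sphere (0 : H) 1, ⟪x, (z : H)⟫_ℂ = 0 ∧ ⟪y, (z : H)⟫_ℂ = 0 := by
  classical
  set S := Submodule.span ℂ ({x, y} : Set H) with hS
  have hfin : FiniteDimensional ℂ S :=
    FiniteDimensional.span_of_finite ℂ (Set.toFinite _)
  have hne : Sᗮ ≠ ⊥ := by
    intro h
    rw [Submodule.orthogonal_eq_bot_iff] at h
    have h1 : Module.rank ℂ S ≤ 2 := by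
      refine (rank_span_le _).trans ?_
      refine (Cardinal.mk_insert_le).trans ?_
      rw [Cardinal.mk_singleton]
      norm_num
    rw [h, rank_top] at h1
    have : (3 : Cardinal) ≤ 2 := hdim.trans h1
    norm_num at this
  obtain ⟨w, hw, hw0⟩ := Submodule.exists_mem_ne_zero_of_ne_bot hne
  refine ⟨⟨((‖w‖⁻¹ : ℝ) : ℂ) • w, ?_⟩, ?_, ?_⟩
  · rw [mem_sphere_zero_iff_norm, norm_smul, Complex.norm_real, norm_inv, norm_norm,
      inv_mul_cancel₀ (norm_ne_zero_iff.2 hw0)]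
  · rw [inner_smul_right, hw x (Submodule.subset_span (by simp)), mul_zero]
  · rw [inner_smul_right, hw y (Submodule.subset_span (by simp)), mul_zero]

/-- Two unit vectors spanning the same complex line. -/
def SameLine (x y : Metric.sphere (0 : H) 1) : Prop := (y : H) ∈ ℂ ∙ (x : H)

theorem SameLine.exists_smul {x y : Metric.sphere (0 : H) 1} (h : SameLine x y) :
    ∃ c : ℂ, ‖c‖ = 1 ∧ (y : H) = c • (x : H) := by
  obtain ⟨c, hc⟩ := Submodule.mem_span_singleton.1 h
  refine ⟨c, ?_, hc.symm⟩
  have := congrArg norm hc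
  simpa [norm_smul] using this

theorem sameLine_of_smul {x y : Metric.sphere (0 : H) 1} {c : ℂ} (h : (y : H) = c • (x : H)) :
    SameLine x y :=
  Submodule.mem_span_singleton.2 ⟨c, h.symm⟩

theorem SameLine.refl (x : Metric.sphere (0 : H) 1) : SameLine x x :=
  Submodule.mem_span_singleton_self _

theorem SameLine.symm {x y : Metric.sphere (0 : H) 1} (h : SameLine x y) : SameLine y x := by
  obtain ⟨c, hc, h⟩ := h.exists_smul
  have hc0 : c ≠ 0 := by
    rintro rfl
    simp at hc
  exact sameLine_of_smul (c := c⁻¹) (by rw [h, smul_smul, inv_mul_cancel₀ hc0, one_smul])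

theorem SameLine.trans {x y z : Metric.sphere (0 : H) 1} (h : SameLine x y) (h' : SameLine y z) :
    SameLine x z := by
  obtain ⟨c, -, h⟩ := h.exists_smul
  obtain ⟨d, -, h'⟩ := h'.exists_smul
  exact sameLine_of_smul (c := d * c) (by rw [h', h, smul_smul])

/-- Lines through the origin, as classes of unit vectors. -/
def lineSetoid (H : Type*) [NormedAddCommGroup H] [InnerProductSpace ℂ H] :
    Setoid (Metric.sphere (0 : H) 1) :=
  ⟨SameLine, SameLine.refl, SameLine.symm, SameLine.trans⟩

theorem SameLine.norm_inner {x y x' y' : Metric.sphere (0 : H) 1} (h : SameLine x y)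
    (h' : SameLine x' y') : ‖⟪(x : H), x'⟫_ℂ‖ = ‖⟪(y : H), y'⟫_ℂ‖ := by
  obtain ⟨c, hc, h⟩ := h.exists_smul
  obtain ⟨d, hd, h'⟩ := h'.exists_smul
  rw [h, h', inner_smul_left, inner_smul_right, norm_mul, norm_mul, RCLike.norm_conj, hc, hd,
    one_mul, one_mul]

theorem not_sameLine_of_inner_eq_zero {x y : Metric.sphere (0 : H) 1}
    (h : ⟪(x : H), y⟫_ℂ = 0) : ¬ SameLine x y := by
  intro hxy
  have := (SameLine.refl x).norm_inner hxy
  rw [h] at this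
  simp at this

theorem mem_span_pair_of_orthogonal {x y w : H}
    (h : ∀ z : Metric.sphere (0 : H) 1, ⟪x, (z : H)⟫_ℂ = 0 → ⟪y, (z : H)⟫_ℂ = 0 →
      ⟪w, (z : H)⟫_ℂ = 0) : w ∈ Submodule.span ℂ ({x, y} : Set H) := by
  set S := Submodule.span ℂ ({x, y} : Set H) with hS
  have hfin : FiniteDimensional ℂ S :=
    FiniteDimensional.span_of_finite ℂ (Set.toFinite _)
  rw [← Submodule.orthogonal_orthogonal S]
  intro v hv
  rcases eq_or_ne v 0 with rfl | hv0
  · simp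
  have hx := hv x (Submodule.subset_span (by simp))
  have hy := hv y (Submodule.subset_span (by simp))
  have h1 := h ⟨((‖v‖⁻¹ : ℝ) : ℂ) • v, by
    rw [mem_sphere_zero_iff_norm, norm_smul, Complex.norm_real, norm_inv, norm_norm,
      inv_mul_cancel₀ (norm_ne_zero_iff.2 hv0)]⟩
    (by simp only [inner_smul_right, hx, mul_zero]) (by simp only [inner_smul_right, hy, mul_zero])
  simp only [inner_smul_right, mul_eq_zero] at h1
  rcases h1 with h1 | h1
  · simp [hv0] at h1
  · exact inner_eq_zero_symm.1 h1

theorem inner_eq_zero_of_mem_span_pair {x y w z : H} (hw : w ∈ Submodule.span ℂ ({x, y} : Set H))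
    (hx : ⟪x, z⟫_ℂ = 0) (hy : ⟪y, z⟫_ℂ = 0) : ⟪w, z⟫_ℂ = 0 := by
  obtain ⟨a, b, rfl⟩ := Submodule.mem_span_pair.1 hw
  rw [inner_add_left, inner_smul_left, inner_smul_left, hx, hy, mul_zero, mul_zero, add_zero]

/-- Coordinatewise orthogonality of pairs of unit vectors. -/
def PairOrth (p q : Metric.sphere (0 : H) 1 × Metric.sphere (0 : H) 1) : Prop :=
  ⟪(p.1 : H), q.1⟫_ℂ = 0 ∧ ⟪(p.2 : H), q.2⟫_ℂ = 0

/-- `r` is orthogonal to everything orthogonal to both `p` and `q`. -/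
def PairSpan (p q r : Metric.sphere (0 : H) 1 × Metric.sphere (0 : H) 1) : Prop :=
  ∀ s, PairOrth p s → PairOrth q s → PairOrth r s

/-- The span of `p` and `q` is minimal, expressed through orthogonality only. -/
def PairColl (p q : Metric.sphere (0 : H) 1 × Metric.sphere (0 : H) 1) : Prop :=
  ∀ r, PairSpan p q r → ¬ PairSpan p p r → PairSpan p r q

/-- To test one coordinate alone, the other is filled with a unit vector orthogonal to both given
ones; this needs dimension three. -/
theorem pairSpan_iff (hdim : 3 ≤ Module.rank ℂ H)
    {p q r : Metric.sphere (0 : H) 1 × Metric.sphere (0 : H) 1} :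
    PairSpan p q r ↔ (r.1 : H) ∈ Submodule.span ℂ ({(p.1 : H), (q.1 : H)} : Set H) ∧
      (r.2 : H) ∈ Submodule.span ℂ ({(p.2 : H), (q.2 : H)} : Set H) := by
  constructor
  · intro h
    obtain ⟨u, hu, hu'⟩ := exists_unit_orthogonal hdim (p.1 : H) q.1
    obtain ⟨v, hv, hv'⟩ := exists_unit_orthogonal hdim (p.2 : H) q.2
    exact ⟨mem_span_pair_of_orthogonal fun z hz hz' => (h (z, v) ⟨hz, hv⟩ ⟨hz', hv'⟩).1,
      mem_span_pair_of_orthogonal fun z hz hz' => (h (u, z) ⟨hu, hz⟩ ⟨hu', hz'⟩).2⟩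
  · rintro ⟨h1, h2⟩ s hp hq
    exact ⟨inner_eq_zero_of_mem_span_pair h1 hp.1 hq.1,
      inner_eq_zero_of_mem_span_pair h2 hp.2 hq.2⟩

theorem pairSpan_self_iff (hdim : 3 ≤ Module.rank ℂ H)
    {p r : Metric.sphere (0 : H) 1 × Metric.sphere (0 : H) 1} :
    PairSpan p p r ↔ SameLine p.1 r.1 ∧ SameLine p.2 r.2 := by
  rw [pairSpan_iff hdim, Set.pair_eq_singleton, Set.pair_eq_singleton]
  rfl

/-- If both coordinates differ, `(p.1, q.2)` lies in the span of `p` and `q` but generates less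
together with `p`. If one coordinate is shared, only the other moves, and there the exchange
property of spans applies. -/
theorem pairColl_iff (hdim : 3 ≤ Module.rank ℂ H)
    {p q : Metric.sphere (0 : H) 1 × Metric.sphere (0 : H) 1} :
    PairColl p q ↔ SameLine p.1 q.1 ∨ SameLine p.2 q.2 := by
  have sub : ∀ x y z : Metric.sphere (0 : H) 1, SameLine x y →
      (y : H) ∈ Submodule.span ℂ ({(x : H), (z : H)} : Set H) := fun x y z h =>
    Submodule.span_mono (by simp) h
  have line : ∀ x y z : Metric.sphere (0 : H) 1, SameLine x y →
      (z : H) ∈ Submodule.span ℂ ({(x : H), (y : H)} : Set H) → SameLine x z := by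
    intro x y z h hz
    obtain ⟨c, -, hc⟩ := h.exists_smul
    obtain ⟨a, b, hab⟩ := Submodule.mem_span_pair.1 hz
    exact sameLine_of_smul (c := a + b * c) (by rw [← hab, hc, smul_smul, add_smul])
  have exch : ∀ x y z : Metric.sphere (0 : H) 1,
      (z : H) ∈ Submodule.span ℂ ({(x : H), (y : H)} : Set H) → ¬ SameLine x z →
      (y : H) ∈ Submodule.span ℂ ({(x : H), (z : H)} : Set H) := by
    intro x y z h hz
    rw [Set.pair_comm] at h ⊢
    exact mem_span_insert_exchange h hz
  constructor
  · intro h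
    by_contra! hc
    have h1 := h (p.1, q.2) ((pairSpan_iff hdim).2
      ⟨Submodule.subset_span (by simp), Submodule.subset_span (by simp)⟩)
      (fun h2 => hc.2 ((pairSpan_self_iff hdim).1 h2).2)
    have h2 := ((pairSpan_iff hdim).1 h1).1
    exact hc.1 (line _ _ _ (SameLine.refl _) h2)
  · intro h r hr hr'
    rw [pairSpan_iff hdim] at hr ⊢
    rw [pairSpan_self_iff hdim] at hr'
    rcases h with h | h
    · exact ⟨sub _ _ _ h, exch _ _ _ hr.2 fun h' => hr' ⟨line _ _ _ h hr.1, h'⟩⟩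
    · exact ⟨exch _ _ _ hr.1 fun h' => hr' ⟨h', line _ _ _ h hr.2⟩, sub _ _ _ h⟩

/-- Being defined from orthogonality, `PairColl` is preserved by `F`, so `F` induces a rook map on
the set of lines. Surjectivity is needed only up to lines, since `PairOrth` ignores phases. -/
theorem pairMap_product_or_swap (hdim : 3 ≤ Module.rank ℂ H)
    {F : Metric.sphere (0 : H) 1 × Metric.sphere (0 : H) 1 →
      Metric.sphere (0 : H) 1 × Metric.sphere (0 : H) 1}
    (horth : ∀ p q, PairOrth p q ↔ PairOrth (F p) (F q))
    (hsurj : ∀ s : Metric.sphere (0 : H) 1 × Metric.sphere (0 : H) 1, ∃ s', SameLine s.1 (F s').1 ∧ SameLine s.2 (F s').2) :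
    (∀ p q, (SameLine p.1 q.1 ↔ SameLine (F p).1 (F q).1) ∧
      (SameLine p.2 q.2 ↔ SameLine (F p).2 (F q).2)) ∨
    (∀ p q, (SameLine p.1 q.1 ↔ SameLine (F p).2 (F q).2) ∧
      (SameLine p.2 q.2 ↔ SameLine (F p).1 (F q).1)) := by
  have orth_congr : ∀ p s s' : Metric.sphere (0 : H) 1 × Metric.sphere (0 : H) 1,
      SameLine s.1 s'.1 → SameLine s.2 s'.2 → (PairOrth p s ↔ PairOrth p s') := by
    intro p s s' h h'
    simp only [PairOrth, ← norm_eq_zero (E := ℂ)]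
    rw [(SameLine.refl p.1).norm_inner h, (SameLine.refl p.2).norm_inner h']
  have hspan : ∀ p q r : Metric.sphere (0 : H) 1 × Metric.sphere (0 : H) 1, PairSpan p q r ↔ PairSpan (F p) (F q) (F r) := by
    intro p q r
    constructor
    · intro h s
      obtain ⟨s', h1, h2⟩ := hsurj s
      simp only [orth_congr _ s _ h1 h2, ← horth]
      exact h s'
    · intro h s
      simp only [horth _ s]
      exact h (F s)
  have span_congr : ∀ p q r r' : Metric.sphere (0 : H) 1 × Metric.sphere (0 : H) 1, SameLine r.1 r'.1 → SameLine r.2 r'.2 →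
      (PairSpan p q r ↔ PairSpan p q r') ∧
      (PairSpan p r q ↔ PairSpan p r' q) := by
    intro p q r r' h h'
    have e : ∀ s, PairOrth r s ↔ PairOrth r' s := by
      intro s
      simp only [PairOrth, ← norm_eq_zero (E := ℂ)]
      rw [h.norm_inner (SameLine.refl s.1), h'.norm_inner (SameLine.refl s.2)]
    simp only [PairSpan, e, and_self]
  have hcoll : ∀ p q : Metric.sphere (0 : H) 1 × Metric.sphere (0 : H) 1, PairColl p q ↔ PairColl (F p) (F q) := by
    intro p q
    constructor
    · intro h r
      obtain ⟨r', h1, h2⟩ := hsurj r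
      rw [(span_congr _ _ _ _ h1 h2).1, (span_congr _ _ _ _ h1 h2).1,
        (span_congr _ _ _ _ h1 h2).2, ← hspan, ← hspan, ← hspan]
      exact h r'
    · intro h r
      rw [hspan p q, hspan p p, hspan p r]
      exact h (F r)
  have hsame : ∀ p q : Metric.sphere (0 : H) 1 × Metric.sphere (0 : H) 1,
      (SameLine p.1 q.1 ∧ SameLine p.2 q.2) ↔
        (SameLine (F p).1 (F q).1 ∧ SameLine (F p).2 (F q).2) := by
    intro p q
    rw [← pairSpan_self_iff hdim, hspan, pairSpan_self_iff hdim]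
  simp only [pairColl_iff hdim] at hcoll
  let X := Quotient (lineSetoid H)
  let mk : Metric.sphere (0 : H) 1 → X := Quotient.mk _
  have mk_eq : ∀ x y, mk x = mk y ↔ SameLine x y := fun x y => Quotient.eq (r := lineSetoid H)
  have out_same : ∀ x, SameLine (mk x).out x := fun x => (mk_eq _ _).1 (Quotient.out_eq _)
  have mk_out : ∀ x : X, mk x.out = x := fun x => Quotient.out_eq _
  let G : X → X → X × X := fun x y => (mk (F (x.out, y.out)).1, mk (F (x.out, y.out)).2)
  have out_eq : ∀ x y : X, x = y ↔ SameLine x.out y.out := by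
    intro x y
    rw [← mk_eq, mk_out, mk_out]
  have hG : RookMap G := by
    constructor
    · intro x y x' y' h
      have h1 := (mk_eq _ _).1 (congrArg Prod.fst h)
      have h2 := (mk_eq _ _).1 (congrArg Prod.snd h)
      rw [out_eq, out_eq y]
      exact (hsame (x.out, y.out) (x'.out, y'.out)).2 ⟨h1, h2⟩
    · intro x y x' y'
      rw [out_eq, out_eq y]
      simp only [G, mk_eq]
      exact hcoll (x.out, y.out) (x'.out, y'.out)
  have G_mk : ∀ p, G (mk p.1) (mk p.2) = (mk (F p).1, mk (F p).2) := by
    intro p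
    obtain ⟨h1, h2⟩ := (hsame ((mk p.1).out, (mk p.2).out) p).1 ⟨out_same _, out_same _⟩
    exact Prod.ext ((mk_eq _ _).2 h1) ((mk_eq _ _).2 h2)
  -- Three pairwise orthogonal unit vectors give the three distinct lines that the grid lemma
  -- requires.
  obtain ⟨a, -, -⟩ := exists_unit_orthogonal hdim (0 : H) 0
  obtain ⟨b, hab, -⟩ := exists_unit_orthogonal hdim (a : H) 0
  obtain ⟨c, hac, hbc⟩ := exists_unit_orthogonal hdim (a : H) b
  rcases hG.product_or_swap (a := mk a) (b := mk b) (c := mk c)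
    (fun h => not_sameLine_of_inner_eq_zero hab ((mk_eq _ _).1 h))
    (fun h => not_sameLine_of_inner_eq_zero hac ((mk_eq _ _).1 h))
    (fun h => not_sameLine_of_inner_eq_zero hbc ((mk_eq _ _).1 h)) with h | h
  · left
    intro p q
    have := h (mk p.1) (mk p.2) (mk q.1) (mk q.2)
    rw [G_mk, G_mk] at this
    simpa only [mk_eq] using this
  · right
    intro p q
    have := h (mk p.1) (mk p.2) (mk q.1) (mk q.2)
    rw [G_mk, G_mk] at this
    simpa only [mk_eq] using this

end Lines

/-! ### Wigner's theorem, by normalizing along a fixed unit vector. -/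

section Wigner

open scoped InnerProductSpace

variable {H : Type*} [NormedAddCommGroup H] [InnerProductSpace ℂ H]

/-- A map preserving the moduli of inner products and reaching every line. -/
structure WignerMap (t : H → H) : Prop where
  norm_inner : ∀ x y, ‖⟪t x, t y⟫_ℂ‖ = ‖⟪x, y⟫_ℂ‖
  surj : ∀ z, ∃ (x : H) (c : ℂ), z = c • t x

theorem norm_inner_self_eq_mul (x : H) : ‖⟪x, x⟫_ℂ‖ = ‖x‖ * ‖x‖ := by
  rw [inner_self_eq_norm_sq_to_K, norm_pow, sq]
  simp

theorem exists_smul_of_norm_inner_eq {x y : H} (hx : x ≠ 0) (h : ‖⟪x, y⟫_ℂ‖ = ‖x‖ * ‖y‖) :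
    ∃ c : ℂ, y = c • x := by
  rcases eq_or_ne y 0 with rfl | hy
  · exact ⟨0, by simp⟩
  · obtain ⟨c, -, hc⟩ := (norm_inner_eq_norm_iff hx hy).1 h
    exact ⟨c, hc⟩

/-- The component orthogonal to `t e` of the representative of the line of `t (e + z)` whose
component along `t e` is `t e`. -/
noncomputable def wignerPart (t : H → H) (e z : H) : H :=
  (⟪t e, t (e + z)⟫_ℂ)⁻¹ • t (e + z) - t e

namespace WignerMap

variable {t : H → H} {e : H}

theorem norm_apply (ht : WignerMap t) (x : H) : ‖t x‖ = ‖x‖ := by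
  have h := ht.norm_inner x x
  rw [norm_inner_self_eq_mul, norm_inner_self_eq_mul] at h
  nlinarith [norm_nonneg (t x), norm_nonneg x]

theorem inner_self (ht : WignerMap t) (he : ‖e‖ = 1) : ⟪t e, t e⟫_ℂ = 1 := by
  rw [inner_self_eq_norm_sq_to_K, ht.norm_apply, he]
  simp

theorem coeff_ne_zero (ht : WignerMap t) (he : ‖e‖ = 1) {z : H} (hz : ⟪e, z⟫_ℂ = 0) :
    ⟪t e, t (e + z)⟫_ℂ ≠ 0 := by
  rw [← norm_ne_zero_iff, ht.norm_inner, inner_add_right, hz, inner_self_eq_norm_sq_to_K, he]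
  simp

theorem norm_coeff (ht : WignerMap t) (he : ‖e‖ = 1) {z : H} (hz : ⟪e, z⟫_ℂ = 0) :
    ‖⟪t e, t (e + z)⟫_ℂ‖ = 1 := by
  rw [ht.norm_inner, inner_add_right, hz, inner_self_eq_norm_sq_to_K, he]
  simp

theorem add_wignerPart (z : H) :
    t e + wignerPart t e z = (⟪t e, t (e + z)⟫_ℂ)⁻¹ • t (e + z) := by
  simp [wignerPart]

theorem inner_wignerPart (ht : WignerMap t) (he : ‖e‖ = 1) {z : H} (hz : ⟪e, z⟫_ℂ = 0) :
    ⟪t e, wignerPart t e z⟫_ℂ = 0 := by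
  rw [wignerPart, inner_sub_right, inner_smul_right, inv_mul_cancel₀ (ht.coeff_ne_zero he hz),
    ht.inner_self he, sub_self]

/-- The normalized vectors `t e + wignerPart t e z` are unimodular multiples of `t (e + z)`. Their
common component `t e` contributes the summand `1`, through which moduli reveal phase. -/
theorem norm_one_add_inner (ht : WignerMap t) (he : ‖e‖ = 1) {z w : H} (hz : ⟪e, z⟫_ℂ = 0)
    (hw : ⟪e, w⟫_ℂ = 0) :
    ‖1 + ⟪wignerPart t e z, wignerPart t e w⟫_ℂ‖ = ‖1 + ⟪z, w⟫_ℂ‖ := by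
  have h1 : 1 + ⟪wignerPart t e z, wignerPart t e w⟫_ℂ =
      ⟪t e + wignerPart t e z, t e + wignerPart t e w⟫_ℂ := by
    rw [inner_add_left, inner_add_right, inner_add_right, ht.inner_self he,
      ht.inner_wignerPart he hw, inner_eq_zero_symm.1 (ht.inner_wignerPart he hz)]
    ring
  have h2 : 1 + ⟪z, w⟫_ℂ = ⟪e + z, e + w⟫_ℂ := by
    rw [inner_add_left, inner_add_right, inner_add_right, hw, inner_eq_zero_symm.1 hz,
      inner_self_eq_norm_sq_to_K, he]
    simp
  rw [h1, h2, add_wignerPart, add_wignerPart, inner_smul_left, inner_smul_right, norm_mul,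
    norm_mul, RCLike.norm_conj, norm_inv, norm_inv, ht.norm_coeff he hz, ht.norm_coeff he hw,
    ht.norm_inner]
  simp

theorem norm_wignerPart (ht : WignerMap t) (he : ‖e‖ = 1) {z : H} (hz : ⟪e, z⟫_ℂ = 0) :
    ‖wignerPart t e z‖ = ‖z‖ := by
  have h := ht.norm_one_add_inner he hz hz
  have key : ∀ x : H, ‖1 + ⟪x, x⟫_ℂ‖ = 1 + ‖x‖ ^ 2 := by
    intro x
    have : 1 + ⟪x, x⟫_ℂ = ((1 + ‖x‖ ^ 2 : ℝ) : ℂ) := by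
      rw [inner_self_eq_norm_sq_to_K]
      push_cast
      rfl
    rw [this, Complex.norm_real, Real.norm_of_nonneg (by positivity)]
  rw [key, key] at h
  nlinarith [norm_nonneg (wignerPart t e z), norm_nonneg z]

/-- Equality case of the Cauchy–Schwarz inequality. -/
theorem exists_smul_wignerPart (ht : WignerMap t) (he : ‖e‖ = 1) {z : H} (hz : ⟪e, z⟫_ℂ = 0) :
    ∃ c : ℂ, t z = c • wignerPart t e z := by
  rcases eq_or_ne z 0 with rfl | hz0
  · exact ⟨0, by rw [zero_smul, ← norm_eq_zero, ht.norm_apply, norm_zero]⟩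
  have hne : wignerPart t e z ≠ 0 := by
    rw [← norm_ne_zero_iff, ht.norm_wignerPart he hz]
    exact norm_ne_zero_iff.2 hz0
  refine exists_smul_of_norm_inner_eq hne ?_
  have h0 : ⟪t e, t z⟫_ℂ = 0 := by
    rw [← norm_eq_zero, ht.norm_inner, hz, norm_zero]
  rw [wignerPart, inner_sub_left, h0, sub_zero, inner_smul_left, norm_mul, RCLike.norm_conj,
    norm_inv, ht.norm_coeff he hz, ht.norm_inner, inner_add_left, hz, zero_add,
    norm_inner_self_eq_mul, ht.norm_apply]
  rw [← wignerPart, ht.norm_wignerPart he hz]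
  simp

theorem norm_smul_eq_one (ht : WignerMap t) (he : ‖e‖ = 1) {z : H} (hz : ⟪e, z⟫_ℂ = 0)
    (hz0 : z ≠ 0) {c : ℂ} (hc : t z = c • wignerPart t e z) : ‖c‖ = 1 := by
  have h := congrArg norm hc
  rw [norm_smul, ht.norm_apply, ht.norm_wignerPart he hz] at h
  exact (mul_eq_right₀ (norm_ne_zero_iff.2 hz0)).1 h.symm

theorem norm_inner_wignerPart (ht : WignerMap t) (he : ‖e‖ = 1) {z w : H} (hz : ⟪e, z⟫_ℂ = 0)
    (hw : ⟪e, w⟫_ℂ = 0) :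
    ‖⟪wignerPart t e z, wignerPart t e w⟫_ℂ‖ = ‖⟪z, w⟫_ℂ‖ := by
  have zero : wignerPart t e 0 = 0 := by
    rw [← norm_eq_zero, ht.norm_wignerPart he (inner_zero_right e), norm_zero]
  rcases eq_or_ne z 0 with rfl | hz0
  · simp [zero]
  rcases eq_or_ne w 0 with rfl | hw0
  · simp [zero]
  obtain ⟨c, hc⟩ := ht.exists_smul_wignerPart he hz
  obtain ⟨d, hd⟩ := ht.exists_smul_wignerPart he hw
  rw [← ht.norm_inner z w, hc, hd, inner_smul_left, inner_smul_right, norm_mul, norm_mul,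
    RCLike.norm_conj, ht.norm_smul_eq_one he hz hz0 hc, ht.norm_smul_eq_one he hw hw0 hd,
    one_mul, one_mul]

/-- Both `‖1 + a‖` and `‖a‖` are preserved, and they determine the real part of `a`. -/
theorem re_inner_wignerPart (ht : WignerMap t) (he : ‖e‖ = 1) {z w : H} (hz : ⟪e, z⟫_ℂ = 0)
    (hw : ⟪e, w⟫_ℂ = 0) :
    (⟪wignerPart t e z, wignerPart t e w⟫_ℂ).re = (⟪z, w⟫_ℂ).re := by
  have key : ∀ a : ℂ, ‖1 + a‖ ^ 2 = 1 + 2 * a.re + ‖a‖ ^ 2 := by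
    intro a
    rw [Complex.sq_norm, Complex.sq_norm, Complex.normSq_apply, Complex.normSq_apply]
    simp
    ring
  have h1 := key ⟪wignerPart t e z, wignerPart t e w⟫_ℂ
  have h2 := key ⟪z, w⟫_ℂ
  rw [ht.norm_one_add_inner he hz hw, ht.norm_inner_wignerPart he hz hw] at h1
  linarith

/-- The squared norm of the defect is a combination of real parts of inner products, all preserved;
so it equals the same expression before applying the map, which is zero. -/
theorem wignerPart_add_smul (ht : WignerMap t) (he : ‖e‖ = 1) {z w : H} (hz : ⟪e, z⟫_ℂ = 0)
    (hw : ⟪e, w⟫_ℂ = 0) (a b : ℝ) :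
    wignerPart t e ((a : ℂ) • z + (b : ℂ) • w) =
      (a : ℂ) • wignerPart t e z + (b : ℂ) • wignerPart t e w := by
  have hv : ⟪e, (a : ℂ) • z + (b : ℂ) • w⟫_ℂ = 0 := by
    rw [inner_add_right, inner_smul_right, inner_smul_right, hz, hw]
    simp
  set v := (a : ℂ) • z + (b : ℂ) • w with hvdef
  have expand : ∀ x y v : H, (⟪v - ((a : ℂ) • x + (b : ℂ) • y),
      v - ((a : ℂ) • x + (b : ℂ) • y)⟫_ℂ).re =
      (⟪v, v⟫_ℂ).re - 2 * a * (⟪v, x⟫_ℂ).re - 2 * b * (⟪v, y⟫_ℂ).re + a ^ 2 * (⟪x, x⟫_ℂ).re +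
        b ^ 2 * (⟪y, y⟫_ℂ).re + 2 * a * b * (⟪x, y⟫_ℂ).re := by
    intro x y v
    have s : ∀ p q : H, (⟪p, q⟫_ℂ).re = (⟪q, p⟫_ℂ).re := fun p q => by
      rw [← inner_conj_symm]; rfl
    simp only [inner_sub_left, inner_sub_right, inner_add_left, inner_add_right, inner_smul_left,
      inner_smul_right, Complex.conj_ofReal, Complex.sub_re, Complex.add_re,
      Complex.re_ofReal_mul]
    rw [s x v, s y v, s y x]
    ring
  have h0 := expand z w v
  rw [← hvdef, sub_self, inner_zero_left, Complex.zero_re] at h0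
  have h1 := expand (wignerPart t e z) (wignerPart t e w) (wignerPart t e v)
  rw [ht.re_inner_wignerPart he hv hv, ht.re_inner_wignerPart he hv hz,
    ht.re_inner_wignerPart he hv hw, ht.re_inner_wignerPart he hz hz,
    ht.re_inner_wignerPart he hw hw, ht.re_inner_wignerPart he hz hw, ← h0] at h1
  rw [← sub_eq_zero, ← norm_eq_zero, ← sq_eq_zero_iff, norm_sq_eq_re_inner (𝕜 := ℂ)]
  exact h1

theorem wignerPart_add (ht : WignerMap t) (he : ‖e‖ = 1) {z w : H} (hz : ⟪e, z⟫_ℂ = 0)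
    (hw : ⟪e, w⟫_ℂ = 0) :
    wignerPart t e (z + w) = wignerPart t e z + wignerPart t e w := by
  simpa using ht.wignerPart_add_smul he hz hw 1 1

/-- The two parts are proportional by Cauchy–Schwarz, with a factor that is unimodular and has real
part zero. -/
theorem wignerPart_I_smul (ht : WignerMap t) (he : ‖e‖ = 1) {z : H} (hz : ⟪e, z⟫_ℂ = 0) :
    wignerPart t e (Complex.I • z) = Complex.I • wignerPart t e z ∨
      wignerPart t e (Complex.I • z) = -Complex.I • wignerPart t e z := by
  have hiz : ⟪e, Complex.I • z⟫_ℂ = 0 := by rw [inner_smul_right, hz, mul_zero]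
  rcases eq_or_ne z 0 with rfl | hz0
  · left
    have zero : wignerPart t e 0 = 0 := by
      rw [← norm_eq_zero, ht.norm_wignerPart he hz, norm_zero]
    simp [zero]
  have hne : wignerPart t e z ≠ 0 := by
    rw [← norm_ne_zero_iff, ht.norm_wignerPart he hz]
    exact norm_ne_zero_iff.2 hz0
  have hn : ‖z‖ ≠ 0 := norm_ne_zero_iff.2 hz0
  obtain ⟨d, hd⟩ := exists_smul_of_norm_inner_eq hne
    (y := wignerPart t e (Complex.I • z)) (by
      rw [ht.norm_inner_wignerPart he hz hiz, ht.norm_wignerPart he hz,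
        ht.norm_wignerPart he hiz, inner_smul_right, norm_mul, norm_smul,
        norm_inner_self_eq_mul]
      ring)
  have hd1 : ‖d‖ = 1 := by
    have := congrArg norm hd
    rw [ht.norm_wignerPart he hiz, norm_smul, norm_smul, ht.norm_wignerPart he hz,
      Complex.norm_I] at this
    exact (mul_right_cancel₀ hn this).symm
  have hre : d.re = 0 := by
    have := ht.re_inner_wignerPart he hz hiz
    rw [hd, inner_smul_right, inner_smul_right, inner_self_eq_norm_sq_to_K,
      inner_self_eq_norm_sq_to_K, ht.norm_wignerPart he hz] at this
    have h2 : ((‖z‖ : ℂ) ^ 2) = ((‖z‖ ^ 2 : ℝ) : ℂ) := by push_cast; rfl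
    change (d * (‖z‖ : ℂ) ^ 2).re = (Complex.I * (‖z‖ : ℂ) ^ 2).re at this
    rw [h2, Complex.re_mul_ofReal, Complex.re_mul_ofReal, Complex.I_re, zero_mul] at this
    exact (mul_eq_zero.1 this).resolve_right (pow_ne_zero _ hn)
  have him : d.im * d.im = 1 := by
    have := Complex.sq_norm d
    rw [hd1, Complex.normSq_apply, hre] at this
    nlinarith
  rcases mul_self_eq_one_iff.1 him with h | h
  · left
    rw [hd]
    congr 1
    exact Complex.ext (by simp [hre]) (by simp [h])
  · right
    rw [hd]
    congr 1
    exact Complex.ext (by simp [hre]) (by simp [h])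

/-- The sign is uniform: if `z` and `w` had opposite signs, additivity at `z + w` would annihilate
one of the two parts, and a vanishing part obeys both rules. -/
theorem wignerPart_I_smul_or (ht : WignerMap t) (he : ‖e‖ = 1) :
    (∀ z, ⟪e, z⟫_ℂ = 0 → wignerPart t e (Complex.I • z) = Complex.I • wignerPart t e z) ∨
      (∀ z, ⟪e, z⟫_ℂ = 0 → wignerPart t e (Complex.I • z) = -Complex.I • wignerPart t e z) := by
  by_contra! h
  obtain ⟨⟨z, hz, h1⟩, w, hw, h2⟩ := h
  have h1' := (ht.wignerPart_I_smul he hz).resolve_left h1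
  have h2' := (ht.wignerPart_I_smul he hw).resolve_right h2
  have hiz : ⟪e, Complex.I • z⟫_ℂ = 0 := by rw [inner_smul_right, hz, mul_zero]
  have hiw : ⟪e, Complex.I • w⟫_ℂ = 0 := by rw [inner_smul_right, hw, mul_zero]
  have hzw : ⟪e, z + w⟫_ℂ = 0 := by rw [inner_add_right, hz, hw, add_zero]
  have h3 := ht.wignerPart_I_smul he hzw
  rw [smul_add, ht.wignerPart_add he hiz hiw, ht.wignerPart_add he hz hw, h1', h2'] at h3
  have cancel : ∀ v : H, Complex.I • v = -Complex.I • v → v = 0 := by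
    intro v hv
    rw [← sub_eq_zero, ← sub_smul, smul_eq_zero] at hv
    refine hv.resolve_left fun h => ?_
    have := congrArg Complex.im h
    norm_num at this
  rcases h3 with h3 | h3
  · have := cancel (wignerPart t e z) (by
      rw [smul_add] at h3
      exact (add_right_cancel h3).symm)
    exact h1 (by rw [h1', this, smul_zero, smul_zero])
  · have := cancel (wignerPart t e w) (by
      rw [smul_add] at h3
      exact add_left_cancel h3)
    exact h2 (by rw [h2', this, smul_zero, smul_zero])

theorem apply_smul (ht : WignerMap t) (a : ℂ) (x : H) : ∃ c : ℂ, t (a • x) = c • t x := by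
  rcases eq_or_ne x 0 with rfl | hx
  · exact ⟨1, by rw [smul_zero, one_smul]⟩
  have hne : t x ≠ 0 := by
    rw [← norm_ne_zero_iff, ht.norm_apply]
    exact norm_ne_zero_iff.2 hx
  refine exists_smul_of_norm_inner_eq hne ?_
  rw [ht.norm_inner, ht.norm_apply, ht.norm_apply, inner_smul_right, norm_mul, norm_smul,
    norm_inner_self_eq_mul]
  ring

theorem exists_apply_eq_smul (ht : WignerMap t) (he : ‖e‖ = 1) {x : H} (hx : ⟪e, x⟫_ℂ ≠ 0) :
    ∃ c : ℂ, t x = c • (t e + wignerPart t e ((⟪e, x⟫_ℂ)⁻¹ • x - e)) ∧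
      ⟪e, (⟪e, x⟫_ℂ)⁻¹ • x - e⟫_ℂ = 0 := by
  have h0 : ⟪e, (⟪e, x⟫_ℂ)⁻¹ • x - e⟫_ℂ = 0 := by
    rw [inner_sub_right, inner_smul_right, inv_mul_cancel₀ hx, inner_self_eq_norm_sq_to_K, he]
    simp
  rw [add_wignerPart]
  set z := (⟪e, x⟫_ℂ)⁻¹ • x - e with hz
  have hc := ht.coeff_ne_zero he h0
  have hxz : x = ⟪e, x⟫_ℂ • (e + z) := by
    rw [hz, add_sub_cancel, smul_smul, mul_inv_cancel₀ hx, one_smul]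
  obtain ⟨d, hd⟩ := ht.apply_smul ⟪e, x⟫_ℂ (e + z)
  rw [← hxz] at hd
  refine ⟨d * ⟪t e, t (e + z)⟫_ℂ, ?_, h0⟩
  rw [smul_smul, mul_assoc, mul_inv_cancel₀ hc, mul_one, hd]

theorem wignerPart_surj (ht : WignerMap t) (he : ‖e‖ = 1) {w : H} (hw : ⟪t e, w⟫_ℂ = 0) :
    ∃ z, ⟪e, z⟫_ℂ = 0 ∧ wignerPart t e z = w := by
  obtain ⟨x, c, hxc⟩ := ht.surj (t e + w)
  have h1 : c * ⟪t e, t x⟫_ℂ = 1 := by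
    rw [← inner_smul_right, ← hxc, inner_add_right, hw, add_zero, ht.inner_self he]
  have hx : ⟪e, x⟫_ℂ ≠ 0 := by
    rw [← norm_ne_zero_iff, ← ht.norm_inner, norm_ne_zero_iff]
    exact right_ne_zero_of_mul_eq_one h1
  obtain ⟨d, hd, hz⟩ := ht.exists_apply_eq_smul he hx
  refine ⟨_, hz, ?_⟩
  rw [hd, smul_smul] at hxc
  have h2 := congrArg (fun v => ⟪t e, v⟫_ℂ) hxc
  simp only [inner_add_right, inner_smul_right, hw, ht.inner_self he,
    ht.inner_wignerPart he hz, add_zero, mul_one] at h2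
  rw [← h2, one_smul] at hxc
  exact (add_left_cancel hxc).symm

theorem exists_semilinear (ht : WignerMap t) (he : ‖e‖ = 1) {σ σ' : ℂ →+* ℂ}
    [RingHomInvPair σ σ'] [RingHomInvPair σ' σ] (hσ : ∀ c, ‖σ c‖ = ‖c‖)
    (hS : ∀ (c : ℂ) z, ⟪e, z⟫_ℂ = 0 → wignerPart t e (c • z) = σ c • wignerPart t e z) :
    ∃ L : H ≃ₛₗᵢ[σ] H, ∀ x, ∃ c : ℂ, t x = c • L x := by
  have hee : ⟪e, e⟫_ℂ = 1 := by
    rw [inner_self_eq_norm_sq_to_K, he]; simp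
  have h0 : ∀ x, ⟪e, x - ⟪e, x⟫_ℂ • e⟫_ℂ = 0 := by
    intro x
    rw [inner_sub_right, inner_smul_right, hee, mul_one, sub_self]
  -- The part map lives on the orthogonal complement of `e`; it is extended semilinearly by sending
  -- `e` to `t e`.
  let f : H →ₛₗ[σ] H :=
    { toFun := fun x => σ ⟪e, x⟫_ℂ • t e + wignerPart t e (x - ⟪e, x⟫_ℂ • e)
      map_add' := fun x y => by
        have : x + y - ⟪e, x + y⟫_ℂ • e = (x - ⟪e, x⟫_ℂ • e) + (y - ⟪e, y⟫_ℂ • e) := by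
          rw [inner_add_right, add_smul]; abel
        rw [this, ht.wignerPart_add he (h0 x) (h0 y), inner_add_right, map_add, add_smul]
        abel
      map_smul' := fun c x => by
        have : c • x - ⟪e, c • x⟫_ℂ • e = c • (x - ⟪e, x⟫_ℂ • e) := by
          rw [inner_smul_right, smul_sub, smul_smul]
        rw [this, hS _ _ (h0 x), inner_smul_right, map_mul, smul_add, smul_smul] }
  have hf : ∀ x, f x = σ ⟪e, x⟫_ℂ • t e + wignerPart t e (x - ⟪e, x⟫_ℂ • e) := fun x => rfl
  have hf0 : ∀ x, ⟪e, x⟫_ℂ = 0 → f x = wignerPart t e x := by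
    intro x hx
    rw [hf, hx, map_zero, zero_smul, zero_smul, zero_add, sub_zero]
  have hfe : f e = t e := by
    have zero : wignerPart t e 0 = 0 := by
      rw [← norm_eq_zero, ht.norm_wignerPart he (inner_zero_right e), norm_zero]
    rw [hf, hee, map_one, one_smul, one_smul, sub_self, zero, add_zero]
  have hnorm : ∀ x, ‖f x‖ = ‖x‖ := by
    intro x
    have h1 : ‖f x‖ * ‖f x‖ = ‖x‖ * ‖x‖ := by
      rw [hf, norm_add_sq_eq_norm_sq_add_norm_sq_of_inner_eq_zero (𝕜 := ℂ) _ _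
        (by rw [inner_smul_left, ht.inner_wignerPart he (h0 x), mul_zero])]
      rw [ht.norm_wignerPart he (h0 x), norm_smul, hσ, ht.norm_apply, ← norm_smul,
        ← norm_add_sq_eq_norm_sq_add_norm_sq_of_inner_eq_zero (𝕜 := ℂ) _ _
        (by rw [inner_smul_left, h0 x, mul_zero]), add_sub_cancel]
    nlinarith [norm_nonneg (f x), norm_nonneg x]
  have hsurj : Function.Surjective f := by
    intro w
    have h1 : ⟪t e, w - ⟪t e, w⟫_ℂ • t e⟫_ℂ = 0 := by
      rw [inner_sub_right, inner_smul_right, ht.inner_self he, mul_one, sub_self]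
    obtain ⟨z, hz, hzw⟩ := ht.wignerPart_surj he h1
    refine ⟨σ' ⟪t e, w⟫_ℂ • e + z, ?_⟩
    rw [map_add, map_smulₛₗ, hf0 z hz, hzw, hfe, RingHomInvPair.comp_apply_eq₂, add_sub_cancel]
  refine ⟨LinearIsometryEquiv.ofSurjective ⟨f, hnorm⟩ hsurj, fun x => ?_⟩
  change ∃ c : ℂ, t x = c • f x
  by_cases hx : ⟪e, x⟫_ℂ = 0
  · rw [hf0 x hx]
    exact ht.exists_smul_wignerPart he hx
  · obtain ⟨c, hc, hz⟩ := ht.exists_apply_eq_smul he hx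
    have hσx : σ ⟪e, x⟫_ℂ ≠ 0 := by
      rw [← norm_ne_zero_iff, hσ]
      exact norm_ne_zero_iff.2 hx
    refine ⟨c * (σ ⟪e, x⟫_ℂ)⁻¹, ?_⟩
    have h1 : x = ⟪e, x⟫_ℂ • (e + ((⟪e, x⟫_ℂ)⁻¹ • x - e)) := by
      rw [add_sub_cancel, smul_smul, mul_inv_cancel₀ hx, one_smul]
    have h2 : f x = σ ⟪e, x⟫_ℂ • (t e + wignerPart t e ((⟪e, x⟫_ℂ)⁻¹ • x - e)) := by
      conv_lhs => rw [h1]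
      rw [map_smulₛₗ, map_add, hfe, hf0 _ hz]
    rw [h2, smul_smul, mul_assoc, inv_mul_cancel₀ hσx, mul_one, hc]

/-- **Wigner's theorem** for maps reaching every line. -/
theorem exists_linear_or_conjLinear (ht : WignerMap t) (he : ‖e‖ = 1) :
    (∃ L : H ≃ₗᵢ[ℂ] H, ∀ x, ∃ c : ℂ, t x = c • L x) ∨
      (∃ L : H ≃ₗᵢ⋆[ℂ] H, ∀ x, ∃ c : ℂ, t x = c • L x) := by
  -- Real-linearity and the rule for `I` together give semilinearity over `ℂ`.
  have split : ∀ (c : ℂ) (z : H), c • z = (c.re : ℂ) • z + (c.im : ℂ) • (Complex.I • z) := by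
    intro c z
    rw [smul_smul, ← add_smul, Complex.re_add_im]
  have hI : ∀ z, ⟪e, z⟫_ℂ = 0 → ⟪e, Complex.I • z⟫_ℂ = 0 := fun z hz => by
    rw [inner_smul_right, hz, mul_zero]
  rcases ht.wignerPart_I_smul_or he with h | h
  · refine Or.inl (ht.exists_semilinear he (fun c => rfl) fun c z hz => ?_)
    rw [split c z, ht.wignerPart_add_smul he hz (hI z hz), h z hz, RingHom.id_apply, ← split]
  · refine Or.inr (ht.exists_semilinear he (fun c => RCLike.norm_conj c) fun c z hz => ?_)
    rw [split c z, ht.wignerPart_add_smul he hz (hI z hz), h z hz,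
      split (starRingEnd ℂ c) (wignerPart t e z)]
    simp

end WignerMap

end Wigner

/-! ### A functional equation on the unit interval. -/

section UnitInterval

/-- Comparing the triples `(s, t, 1 - s - t)` and `(s + t, 1 - s - t, 0)` gives additivity, and
nonnegativity makes `h` monotone. Thus `h` is the identity on rationals, rational approximation from
below gives `t ≤ h t`, and the same bound at `1 - t` gives the reverse. -/
theorem eq_id_of_sum_eq_one {h : ℝ → ℝ} (h0 : h 0 = 0) (hnn : ∀ t, 0 ≤ t → t ≤ 1 → 0 ≤ h t)
    (hsum : ∀ r s t, 0 ≤ r → 0 ≤ s → 0 ≤ t → r + s + t = 1 → h r + h s + h t = 1)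
    {t : ℝ} (ht0 : 0 ≤ t) (ht1 : t ≤ 1) : h t = t := by
  have compl : ∀ t, 0 ≤ t → t ≤ 1 → h t + h (1 - t) = 1 := by
    intro t ht0 ht1
    have := hsum t (1 - t) 0 ht0 (by linarith) le_rfl (by ring)
    rwa [h0, add_zero] at this
  have add : ∀ s t, 0 ≤ s → 0 ≤ t → s + t ≤ 1 → h (s + t) = h s + h t := by
    intro s t hs ht hst
    have h1 := hsum s t (1 - (s + t)) hs ht (by linarith) (by ring)
    have h2 := compl (s + t) (by linarith) hst
    linarith
  have mono : ∀ s t, 0 ≤ s → s ≤ t → t ≤ 1 → h s ≤ h t := by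
    intro s t hs hst ht
    have h1 := add s (t - s) hs (by linarith) (by linarith)
    have h2 := hnn (t - s) (by linarith) (by linarith)
    rw [add_sub_cancel] at h1
    linarith
  have h1 : h 1 = 1 := by
    have := compl 1 zero_le_one le_rfl
    rwa [sub_self, h0, add_zero] at this
  have nat : ∀ n : ℕ, 0 < n → ∀ k : ℕ, k ≤ n → h (k / n) = k * h (1 / n) := by
    intro n hn k
    have hn' : (0 : ℝ) < n := Nat.cast_pos.2 hn
    induction k with
    | zero => intro _; simp [h0]
    | succ k ih =>
      intro hk
      have hk' : ((k : ℝ) + 1) ≤ n := by exact_mod_cast hk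
      have e : ((k + 1 : ℕ) : ℝ) / n = k / n + 1 / n := by
        push_cast
        rw [add_div]
      rw [e, add _ _ (by positivity) (by positivity) (by rw [← add_div]; exact (div_le_one hn').2 hk'),
        ih (by omega)]
      push_cast
      ring
  have frac : ∀ n : ℕ, 0 < n → ∀ k : ℕ, k ≤ n → h (k / n) = k / n := by
    intro n hn k hk
    have hn' : (n : ℝ) ≠ 0 := by positivity
    have e := nat n hn n le_rfl
    rw [div_self hn', h1] at e
    have e' : h (1 / n) = 1 / n := eq_div_of_mul_eq hn' (by rw [mul_comm]; exact e.symm)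
    rw [nat n hn k hk, e', mul_one_div]
  have lower : ∀ t, 0 ≤ t → t ≤ 1 → t ≤ h t := by
    intro t ht0 ht1
    refine le_of_forall_pos_lt_add fun ε hε => ?_
    obtain ⟨n, hn⟩ := exists_nat_one_div_lt hε
    have hN : (0 : ℝ) < (n + 1 : ℕ) := by positivity
    set k := ⌊((n + 1 : ℕ) : ℝ) * t⌋₊ with hk
    have hk1 : (k : ℝ) ≤ (n + 1 : ℕ) * t := Nat.floor_le (by positivity)
    have hk2 : ((n + 1 : ℕ) : ℝ) * t < k + 1 := Nat.lt_floor_add_one _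
    have hkn : k ≤ n + 1 := by
      have : (k : ℝ) ≤ (n + 1 : ℕ) := hk1.trans (mul_le_of_le_one_right hN.le ht1)
      exact_mod_cast this
    have hkt : (k : ℝ) / (n + 1 : ℕ) ≤ t := by
      rw [div_le_iff₀ hN]
      linarith
    have h2 := mono _ t (by positivity) hkt ht1
    rw [frac _ n.succ_pos _ hkn] at h2
    have h3 : t < k / (n + 1 : ℕ) + 1 / (n + 1 : ℕ) := by
      rw [← add_div, lt_div_iff₀ hN]
      linarith
    push_cast at h2 h3
    linarith
  have h2 := lower t ht0 ht1
  have h3 := lower (1 - t) (by linarith) (by linarith)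
  have h4 := compl t ht0 ht1
  linarith

end UnitInterval

/-! ### The action on atoms and preservation of transition probabilities. -/

section Automorphisms

open InnerProductSpace

open scoped InnerProductSpace

variable {H : Type*} [NormedAddCommGroup H] [InnerProductSpace ℂ H]

/-- One Gram–Schmidt step. Both coefficients depend only on `⟪y, y'⟫`, so pairs with equal inner
products have equal coordinates. -/
theorem exists_unit_decomposition {y y' : H} (hy : ‖y‖ = 1) (hy' : ‖y'‖ = 1)
    (h : ‖⟪y, y'⟫_ℂ‖ ≠ 1) :
    ∃ z : H, ‖z‖ = 1 ∧ ⟪y, z⟫_ℂ = 0 ∧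
      y' = ⟪y, y'⟫_ℂ • y + ((√(1 - ‖⟪y, y'⟫_ℂ‖ ^ 2) : ℝ) : ℂ) • z := by
  set a := ⟪y, y'⟫_ℂ with ha
  set w := y' - a • y with hw
  have hyw : ⟪y, w⟫_ℂ = 0 := by
    rw [hw, inner_sub_right, inner_smul_right, inner_self_eq_norm_sq_to_K, hy, ← ha]
    simp
  have hnw : ‖w‖ ^ 2 = 1 - ‖a‖ ^ 2 := by
    have h1 := norm_add_sq_eq_norm_sq_add_norm_sq_of_inner_eq_zero (𝕜 := ℂ) (a • y) w
      (by rw [inner_smul_left, hyw, mul_zero])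
    rw [hw, add_sub_cancel, ← hw, norm_smul, hy, hy'] at h1
    nlinarith
  have hw0 : ‖w‖ ≠ 0 := by
    intro h0
    rw [h0] at hnw
    apply h
    have : ‖a‖ ^ 2 = 1 := by linarith
    nlinarith [norm_nonneg a]
  rw [← hnw, Real.sqrt_sq (norm_nonneg w)]
  refine ⟨((‖w‖⁻¹ : ℝ) : ℂ) • w, ?_, ?_, ?_⟩
  · rw [norm_smul, Complex.norm_real, norm_inv, norm_norm, inv_mul_cancel₀ hw0]
  · rw [inner_smul_right, hyw, mul_zero]
  · rw [smul_smul, ← Complex.ofReal_mul, mul_inv_cancel₀ hw0, Complex.ofReal_one, one_smul, hw,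
      add_sub_cancel]

/-- Pythagoras gives a vanishing real part; applied to `σ' I • y` it gives the imaginary part, for
linear and conjugate-linear maps alike. -/
theorem LinearIsometryEquiv.inner_map_eq_zero {σ σ' : ℂ →+* ℂ} [RingHomInvPair σ σ']
    [RingHomInvPair σ' σ] (L : H ≃ₛₗᵢ[σ] H) {x y : H} (h : ⟪x, y⟫_ℂ = 0) : ⟪L x, L y⟫_ℂ = 0 := by
  have re : ∀ y, ⟪x, y⟫_ℂ = 0 → (⟪L x, L y⟫_ℂ).re = 0 := by
    intro y h
    have h1 := norm_add_sq_eq_norm_sq_add_norm_sq_of_inner_eq_zero (𝕜 := ℂ) x y h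
    have h2 := norm_add_sq (𝕜 := ℂ) (L x) (L y)
    rw [← map_add, L.norm_map, L.norm_map, L.norm_map] at h2
    change _ = _ + 2 * (⟪L x, L y⟫_ℂ).re + _ at h2
    linarith
  have h1 := re y h
  have h2 := re (σ' Complex.I • y) (by rw [inner_smul_right, h, mul_zero])
  rw [L.map_smulₛₗ, RingHomInvPair.comp_apply_eq₂, inner_smul_right, Complex.I_mul_re] at h2
  exact Complex.ext h1 (neg_eq_zero.1 h2)

theorem exists_isometry_of_norm_inner {e : H} (he : ‖e‖ = 1)
    {u : Metric.sphere (0 : H) 1 → Metric.sphere (0 : H) 1}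
    (hu : ∀ x y, ‖⟪(u x : H), u y⟫_ℂ‖ = ‖⟪(x : H), y⟫_ℂ‖)
    (hsurj : ∀ z, ∃ x, SameLine z (u x)) :
    (∃ L : H ≃ₗᵢ[ℂ] H, ∀ x, ∃ c : ℂ, ‖c‖ = 1 ∧ (u x : H) = c • L x) ∨
      (∃ L : H ≃ₗᵢ⋆[ℂ] H, ∀ x, ∃ c : ℂ, ‖c‖ = 1 ∧ (u x : H) = c • L x) := by
  classical
  have unit : ∀ x : H, x ≠ 0 → ((‖x‖⁻¹ : ℝ) : ℂ) • x ∈ Metric.sphere (0 : H) 1 := by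
    intro x hx
    rw [mem_sphere_zero_iff_norm, norm_smul, Complex.norm_real, norm_inv, norm_norm,
      inv_mul_cancel₀ (norm_ne_zero_iff.2 hx)]
  -- Radial extension of `u`, with value `0` at the origin.
  let t : H → H := fun x => if hx : x ≠ 0 then (‖x‖ : ℂ) • (u ⟨_, unit x hx⟩ : H) else 0
  have t_unit : ∀ x : Metric.sphere (0 : H) 1, t x = u x := by
    intro x
    have hx : (x : H) ≠ 0 := ne_zero_of_mem_unit_sphere x
    have e : (⟨_, unit x hx⟩ : Metric.sphere (0 : H) 1) = x := by
      ext
      simp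
    simp only [t, dif_pos hx, e]
    simp
  have ht : WignerMap t := by
    constructor
    · intro x y
      by_cases hx : x ≠ 0
      · by_cases hy : y ≠ 0
        · have hx' := norm_ne_zero_iff.2 hx
          have hy' := norm_ne_zero_iff.2 hy
          simp only [t, dif_pos hx, dif_pos hy]
          rw [inner_smul_left, inner_smul_right, norm_mul, norm_mul, hu, inner_smul_left,
            inner_smul_right, norm_mul, norm_mul, RCLike.norm_conj, RCLike.norm_conj]
          simp only [Complex.norm_real, norm_norm, norm_inv]
          field_simp
        · rw [not_not] at hy
          simp [t, hy]
      · rw [not_not] at hx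
        simp [t, hx]
    · intro z
      rcases eq_or_ne z 0 with rfl | hz
      · exact ⟨0, 0, by simp⟩
      obtain ⟨x, hx⟩ := hsurj ⟨_, unit z hz⟩
      obtain ⟨c, -, hc⟩ := hx.symm.exists_smul
      refine ⟨x, (‖z‖ : ℂ) * c, ?_⟩
      rw [t_unit, mul_smul, ← hc]
      change z = (‖z‖ : ℂ) • ((‖z‖⁻¹ : ℝ) : ℂ) • z
      rw [smul_smul, ← Complex.ofReal_mul, mul_inv_cancel₀ (norm_ne_zero_iff.2 hz),
        Complex.ofReal_one, one_smul]
  have fin : ∀ (L : H → H) (hL : ∀ x, ‖L x‖ = ‖x‖), (∀ x, ∃ c : ℂ, t x = c • L x) →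
      ∀ x : Metric.sphere (0 : H) 1, ∃ c : ℂ, ‖c‖ = 1 ∧ (u x : H) = c • L x := by
    intro L hL h x
    obtain ⟨c, hc⟩ := h x
    rw [t_unit] at hc
    refine ⟨c, ?_, hc⟩
    have := congrArg norm hc
    rw [norm_smul, hL] at this
    simpa using this.symm
  rcases ht.exists_linear_or_conjLinear he with ⟨L, hL⟩ | ⟨L, hL⟩
  · exact Or.inl ⟨L, fin L L.norm_map hL⟩
  · exact Or.inr ⟨L, fin L L.norm_map hL⟩

variable [CompleteSpace H]

theorem exists_PI_of_inner_eq {x x' y y' : H} (hx : ‖x‖ = 1) (hx' : ‖x'‖ = 1) (hy : ‖y‖ = 1)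
    (hy' : ‖y'‖ = 1) (h : ⟪x, x'⟫_ℂ = ⟪y, y'⟫_ℂ) (h1 : ‖⟪y, y'⟫_ℂ‖ ≠ 1) :
    ∃ W : PI H, W.1 y = x ∧ W.1 y' = x' := by
  obtain ⟨z, hz, hyz, hdz⟩ := exists_unit_decomposition hy hy' h1
  obtain ⟨w, hw, hxw, hdw⟩ := exists_unit_decomposition hx hx' (h ▸ h1)
  rw [h] at hdw
  have hW1 : (rankOne ℂ x y + rankOne ℂ w z) y = x := by
    simp [inner_eq_zero_symm.1 hyz, hy]
  have hW2 : (rankOne ℂ x y + rankOne ℂ w z) z = w := by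
    simp [hyz, hz]
  refine ⟨⟨_, isPartialIsometry_rankOne_add_rankOne hx hw hy hz hxw hyz⟩, hW1, ?_⟩
  change (rankOne ℂ x y + rankOne ℂ w z) y' = x'
  rw [hdw]
  conv_lhs => rw [hdz]
  rw [map_add, map_smul, map_smul, hW1, hW2]

/-- Bijections preserving order and orthogonality in both directions. -/
structure IsPIAutomorphism (φ : PI H → PI H) : Prop where
  bijective : Function.Bijective φ
  le_iff : ∀ P Q, PILe P Q ↔ PILe (φ P) (φ Q)
  orthogonal_iff : ∀ P Q, PIOrthogonal P Q ↔ PIOrthogonal (φ P) (φ Q)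

namespace IsPIAutomorphism

variable {φ : PI H → PI H}

theorem comp_adjointPI (hφ : IsPIAutomorphism φ) :
    IsPIAutomorphism (fun P => φ (adjointPI P)) where
  bijective := hφ.bijective.comp (Function.Involutive.bijective adjointPI_adjointPI)
  le_iff P Q := by rw [← hφ.le_iff, adjointPI_le_iff]
  orthogonal_iff P Q := by rw [← hφ.orthogonal_iff, adjointPI_orthogonal_iff]

theorem map_zero (hφ : IsPIAutomorphism φ) : φ zeroPI = zeroPI := by
  obtain ⟨P, hP⟩ := hφ.bijective.2 zeroPI
  refine PILe.antisymm ?_ (zeroPI_le _)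
  have := (hφ.le_iff zeroPI P).1 (zeroPI_le P)
  rwa [hP] at this

theorem map_eq_zero_iff (hφ : IsPIAutomorphism φ) {P : PI H} : φ P = zeroPI ↔ P = zeroPI := by
  rw [← hφ.map_zero, hφ.bijective.1.eq_iff, hφ.map_zero]

/-- An atom below `φ (atom x y)` pulls back to a nonzero element below `atom x y`, hence to `atom x
y` itself. -/
theorem exists_map_atom_eq (hφ : IsPIAutomorphism φ) (x y : Metric.sphere (0 : H) 1) :
    ∃ x' y', φ (atom x y) = atom x' y' := by
  obtain ⟨x', y', h⟩ := exists_atom_le fun h => atom_ne_zero x y (hφ.map_eq_zero_iff.1 h)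
  obtain ⟨Q, hQ⟩ := hφ.bijective.2 (atom x' y')
  rw [← hQ, ← hφ.le_iff] at h
  rcases eq_zero_or_eq_of_le_atom h with h | h
  · rw [h, hφ.map_zero] at hQ
    exact absurd hQ.symm (atom_ne_zero x' y')
  · exact ⟨x', y', by rw [← hQ, h]⟩

theorem exists_eq_map_atom (hφ : IsPIAutomorphism φ) (x y : Metric.sphere (0 : H) 1) :
    ∃ x' y', atom x y = φ (atom x' y') := by
  obtain ⟨Q, hQ⟩ := hφ.bijective.2 (atom x y)
  have hQ0 : Q ≠ zeroPI := by
    intro h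
    rw [h, hφ.map_zero] at hQ
    exact atom_ne_zero x y hQ.symm
  obtain ⟨x', y', h⟩ := exists_atom_le hQ0
  rw [hφ.le_iff, hQ] at h
  rcases eq_zero_or_eq_of_le_atom h with h | h
  · exact absurd (hφ.map_eq_zero_iff.1 h) (atom_ne_zero x' y')
  · exact ⟨x', y', h.symm⟩

theorem map_apply_of_map_atom (hφ : IsPIAutomorphism φ) {x y : Metric.sphere (0 : H) 1} {f : ℂ}
    {a b : H} (hf : ‖f‖ = 1) (ha : ‖a‖ = 1) (hb : ‖b‖ = 1)
    (h : (φ (atom x y)).1 = f • rankOne ℂ a b) {W : PI H} (hW : W.1 y = x) :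
    (φ W).1 b = f • a := by
  have h1 : (φ (atom x y)).1 b = f • a := by
    rw [h]
    simp [hb]
  have h2 := (hφ.le_iff _ _).1 (atom_le_iff.2 hW)
  rw [← h1]
  refine (piLe_iff.1 h2 _ ((φ (atom x y)).2.mem_initialSpace_of_norm ?_)).symm
  rw [h1, norm_smul, hf, ha, hb, one_mul]

end IsPIAutomorphism

theorem sameLine_of_atom_eq {x y x' y' : Metric.sphere (0 : H) 1} (h : atom x y = atom x' y') :
    SameLine x x' ∧ SameLine y y' := by
  constructor
  · refine SameLine.symm (sameLine_of_smul (c := ⟪(y' : H), y⟫_ℂ) ?_)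
    rw [← atom_apply_self x y, h, atom_apply]
  · refine SameLine.symm (sameLine_of_smul (c := ⟪(y' : H), y⟫_ℂ) ?_)
    have h1 : (y : H) ∈ initialSpace (atom x y).1 := mem_initialSpace_atom.2 (by simp)
    rw [h] at h1
    exact (mem_initialSpace_atom.1 h1).symm

/-- `φ` acts on rank-one partial isometries through the maps `u` and `v` of lines. -/
structure ActsBy (φ : PI H → PI H) (u v : Metric.sphere (0 : H) 1 → Metric.sphere (0 : H) 1) :
    Prop where
  map_atom : ∀ x y, ∃ f : ℂ, ‖f‖ = 1 ∧ (φ (atom x y)).1 = f • rankOne ℂ (u x : H) (v y : H)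
  congr_left : ∀ x x', SameLine x x' → SameLine (u x) (u x')
  congr_right : ∀ x x', SameLine x x' → SameLine (v x) (v x')
  orth_left : ∀ x x' : Metric.sphere (0 : H) 1, ⟪(x : H), x'⟫_ℂ = 0 ↔ ⟪(u x : H), u x'⟫_ℂ = 0
  surj_left : ∀ z, ∃ x, SameLine z (u x)
  surj_right : ∀ z, ∃ x, SameLine z (v x)

theorem IsPIAutomorphism.exists_actsBy (hdim : 3 ≤ Module.rank ℂ H) {φ : PI H → PI H}
    (hφ : IsPIAutomorphism φ) :
    ∃ u v, ActsBy φ u v ∨ ActsBy (fun P => φ (adjointPI P)) u v := by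
  choose g k hgk using hφ.exists_map_atom_eq
  let F : Metric.sphere (0 : H) 1 × Metric.sphere (0 : H) 1 →
    Metric.sphere (0 : H) 1 × Metric.sphere (0 : H) 1 := fun p => (g p.1 p.2, k p.1 p.2)
  have horth : ∀ p q, PairOrth p q ↔ PairOrth (F p) (F q) := by
    intro p q
    simp only [PairOrth, ← atom_orthogonal_iff, F]
    rw [hφ.orthogonal_iff, hgk, hgk]
  have hsurj : ∀ s : Metric.sphere (0 : H) 1 × Metric.sphere (0 : H) 1, ∃ s',
      SameLine s.1 (F s').1 ∧ SameLine s.2 (F s').2 := by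
    intro s
    obtain ⟨x', y', h⟩ := hφ.exists_eq_map_atom s.1 s.2
    rw [hgk] at h
    exact ⟨(x', y'), sameLine_of_atom_eq h⟩
  obtain ⟨o, -, -⟩ := exists_unit_orthogonal hdim (0 : H) 0
  have main : ∀ (ψ : PI H → PI H) (F : Metric.sphere (0 : H) 1 × Metric.sphere (0 : H) 1 →
      Metric.sphere (0 : H) 1 × Metric.sphere (0 : H) 1),
      (∀ p, ψ (atom p.1 p.2) = atom (F p).1 (F p).2) →
      (∀ p q, PairOrth p q ↔ PairOrth (F p) (F q)) →
      (∀ s : Metric.sphere (0 : H) 1 × Metric.sphere (0 : H) 1, ∃ s',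
        SameLine s.1 (F s').1 ∧ SameLine s.2 (F s').2) →
      (∀ p q, (SameLine p.1 q.1 ↔ SameLine (F p).1 (F q).1) ∧
        (SameLine p.2 q.2 ↔ SameLine (F p).2 (F q).2)) →
      ActsBy ψ (fun x => (F (x, o)).1) (fun y => (F (o, y)).2) := by
    intro ψ F hψ horth hsurj hF
    have h1 : ∀ x y, SameLine (F (x, o)).1 (F (x, y)).1 := fun x y =>
      (hF (x, o) (x, y)).1.1 (SameLine.refl x)
    have h2 : ∀ x y, SameLine (F (o, y)).2 (F (x, y)).2 := fun x y =>
      (hF (o, y) (x, y)).2.1 (SameLine.refl y)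
    have orth_congr : ∀ {a b a' b' : Metric.sphere (0 : H) 1}, SameLine a a' → SameLine b b' →
        (⟪(a : H), b⟫_ℂ = 0 ↔ ⟪(a' : H), b'⟫_ℂ = 0) := by
      intro a b a' b' h h'
      rw [← norm_eq_zero, h.norm_inner h', norm_eq_zero]
    -- A second coordinate orthogonal to `o` turns orthogonality of the first coordinates alone into
    -- orthogonality of pairs.
    obtain ⟨y, hy, -⟩ := exists_unit_orthogonal hdim (o : H) 0
    have orth : ∀ x x' : Metric.sphere (0 : H) 1, ⟪(x : H), x'⟫_ℂ = 0 →
        PairOrth (F (x, o)) (F (x', y)) := fun x x' h => (horth (x, o) (x', y)).1 ⟨h, hy⟩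
    have hoy : ⟪((F (o, o)).2 : H), (F (o, y)).2⟫_ℂ = 0 := by
      obtain ⟨z, hz, -⟩ := exists_unit_orthogonal hdim (o : H) 0
      exact (orth_congr (SameLine.refl _) (h2 z y)).2 (orth o z hz).2
    constructor
    · intro x y
      obtain ⟨c, hc, hcx⟩ := (h1 x y).exists_smul
      obtain ⟨d, hd, hdy⟩ := (h2 x y).exists_smul
      refine ⟨c * starRingEnd ℂ d, by rw [norm_mul, RCLike.norm_conj, hc, hd, one_mul], ?_⟩
      rw [hψ (x, y)]
      change rankOne ℂ ((F (x, y)).1 : H) ((F (x, y)).2 : H) = _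
      rw [hcx, hdy]
      ext w
      simp only [rankOne_apply, inner_smul_left, smul_apply, smul_smul]
      congr 1
      ring
    · exact fun x x' h => (hF (x, o) (x', o)).1.1 h
    · exact fun x x' h => (hF (o, x) (o, x')).2.1 h
    · intro x x'
      constructor
      · intro h
        exact (orth_congr (SameLine.refl _) (h1 x' y)).2 (orth x x' h).1
      · intro h
        refine ((horth (x, o) (x', y)).2 ⟨?_, ?_⟩).1
        · exact (orth_congr (SameLine.refl _) (h1 x' y)).1 h
        · exact (orth_congr (h2 x o) (h2 x' y)).1 hoy
    · intro z
      obtain ⟨s, hs, -⟩ := hsurj (z, z)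
      exact ⟨s.1, hs.trans (h1 s.1 s.2).symm⟩
    · intro z
      obtain ⟨s, -, hs⟩ := hsurj (z, z)
      exact ⟨s.2, hs.trans (h2 s.1 s.2).symm⟩
  rcases pairMap_product_or_swap hdim horth hsurj with h | h
  · exact ⟨_, _, Or.inl (main φ F (fun p => hgk p.1 p.2) horth hsurj h)⟩
  · have hadj : ∀ x y : Metric.sphere (0 : H) 1, adjointPI (atom x y) = atom y x := fun x y =>
      Subtype.ext (adjoint_rankOne _ _)
    refine ⟨_, _, Or.inr (main _ (fun p => F p.swap) (fun p => ?_) (fun p q => ?_) (fun s => ?_)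
      fun p q => ?_)⟩
    · rw [hadj]
      exact hgk p.2 p.1
    · rw [← horth]
      exact and_comm
    · obtain ⟨s', hs'⟩ := hsurj s
      exact ⟨s'.swap, hs'⟩
    · exact ⟨(h p.swap q.swap).2, (h p.swap q.swap).1⟩

namespace ActsBy

variable {φ : PI H → PI H} {u v : Metric.sphere (0 : H) 1 → Metric.sphere (0 : H) 1}

theorem map_apply (h : ActsBy φ u v) (hφ : IsPIAutomorphism φ) {W : PI H}
    {x y : Metric.sphere (0 : H) 1} (hW : W.1 y = x) :
    ∃ f : ℂ, ‖f‖ = 1 ∧ (φ W).1 (v y) = f • (u x : H) := by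
  obtain ⟨f, hf, hfa⟩ := h.map_atom x y
  exact ⟨f, hf, hφ.map_apply_of_map_atom hf (norm_eq_of_mem_sphere _) (norm_eq_of_mem_sphere _)
    hfa hW⟩

/-- For `W` carrying `y, y'` to `x, x'`, the partial isometry `φ W` carries `v y, v y'` to `u x, u
x'` up to phases and preserves their inner product. When the modulus is `1` each pair lies on one
line. -/
theorem norm_inner_eq_of_inner_eq (h : ActsBy φ u v) (hφ : IsPIAutomorphism φ)
    {x x' y y' : Metric.sphere (0 : H) 1} (hxy : ⟪(x : H), x'⟫_ℂ = ⟪(y : H), y'⟫_ℂ) :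
    ‖⟪(u x : H), u x'⟫_ℂ‖ = ‖⟪(v y : H), v y'⟫_ℂ‖ := by
  have same : ∀ z w : Metric.sphere (0 : H) 1, ‖⟪(z : H), w⟫_ℂ‖ = 1 → SameLine z w := by
    intro z w hzw
    obtain ⟨c, hc⟩ := exists_smul_of_norm_inner_eq (ne_zero_of_mem_unit_sphere z)
      (y := (w : H)) (by simpa using hzw)
    exact sameLine_of_smul hc
  by_cases h1 : ‖⟪(y : H), y'⟫_ℂ‖ = 1
  · have hy := h.congr_right _ _ (same _ _ h1)
    have hx := h.congr_left _ _ (same _ _ (hxy ▸ h1))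
    rw [← (SameLine.refl (u x)).norm_inner hx, ← (SameLine.refl (v y)).norm_inner hy]
    simp
  · obtain ⟨W, hW, hW'⟩ := exists_PI_of_inner_eq (norm_eq_of_mem_sphere x)
      (norm_eq_of_mem_sphere x') (norm_eq_of_mem_sphere y) (norm_eq_of_mem_sphere y') hxy h1
    obtain ⟨f, hf, hf1⟩ := h.map_apply hφ hW
    obtain ⟨f', hf', hf1'⟩ := h.map_apply hφ hW'
    have h2 := (φ W).2.inner_apply_apply (x := (v y : H))
      (by rw [hf1, norm_smul, hf]; simp) (v y')
    rw [← h2, hf1, hf1', inner_smul_left, inner_smul_right, norm_mul, norm_mul,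
      RCLike.norm_conj, hf, hf', one_mul, one_mul]

theorem norm_inner_eq (h : ActsBy φ u v) (hφ : IsPIAutomorphism φ)
    {x x' y y' : Metric.sphere (0 : H) 1} (hxy : ‖⟪(x : H), x'⟫_ℂ‖ = ‖⟪(y : H), y'⟫_ℂ‖) :
    ‖⟪(u x : H), u x'⟫_ℂ‖ = ‖⟪(v y : H), v y'⟫_ℂ‖ := by
  obtain ⟨c, hc, hcx⟩ : ∃ c : ℂ, ‖c‖ = 1 ∧ ⟪(x : H), x'⟫_ℂ = c * ⟪(y : H), y'⟫_ℂ := by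
    by_cases h0 : ⟪(y : H), y'⟫_ℂ = 0
    · refine ⟨1, norm_one, ?_⟩
      rw [h0, norm_zero, norm_eq_zero] at hxy
      rw [h0, hxy, mul_zero]
    · refine ⟨⟪(x : H), x'⟫_ℂ / ⟪(y : H), y'⟫_ℂ, ?_, (div_mul_cancel₀ _ h0).symm⟩
      rw [norm_div, hxy, div_self (norm_ne_zero_iff.2 h0)]
  let w : Metric.sphere (0 : H) 1 := ⟨c • (y' : H), by
    rw [mem_sphere_zero_iff_norm, norm_smul, hc]; simp⟩
  have hw : SameLine y' w := sameLine_of_smul (c := c) rfl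
  rw [h.norm_inner_eq_of_inner_eq hφ (y := y) (y' := w)
    (by rw [hcx, ← inner_smul_right])]
  exact ((SameLine.refl (v y)).norm_inner (h.congr_right _ _ hw)).symm

/-- Whatever is orthogonal to the three `u eᵢ` is orthogonal to `u x`, by pulling back along `u`.
Hence `u x` equals its projection onto their span, and Parseval applies. -/
theorem sum_sq_eq_one (h : ActsBy φ u v) {e₁ e₂ e₃ x : Metric.sphere (0 : H) 1}
    (h12 : ⟪(e₁ : H), e₂⟫_ℂ = 0) (h13 : ⟪(e₁ : H), e₃⟫_ℂ = 0) (h23 : ⟪(e₂ : H), e₃⟫_ℂ = 0)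
    {a b c : ℂ} (hx : (x : H) = a • (e₁ : H) + b • (e₂ : H) + c • (e₃ : H)) :
    ‖⟪(u e₁ : H), u x⟫_ℂ‖ ^ 2 + ‖⟪(u e₂ : H), u x⟫_ℂ‖ ^ 2 + ‖⟪(u e₃ : H), u x⟫_ℂ‖ ^ 2 = 1 := by
  have k12 := (h.orth_left _ _).1 h12
  have k13 := (h.orth_left _ _).1 h13
  have k23 := (h.orth_left _ _).1 h23
  have k21 := inner_eq_zero_symm.1 k12
  have k31 := inner_eq_zero_symm.1 k13
  have k32 := inner_eq_zero_symm.1 k23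
  have n : ∀ z : Metric.sphere (0 : H) 1, ⟪(z : H), z⟫_ℂ = 1 := fun z => by
    rw [inner_self_eq_norm_sq_to_K, norm_eq_of_mem_sphere z]; simp
  set p := ⟪(u e₁ : H), u x⟫_ℂ with hp
  set q := ⟪(u e₂ : H), u x⟫_ℂ with hq
  set r := ⟪(u e₃ : H), u x⟫_ℂ with hr
  set s : H := p • (u e₁ : H) + q • (u e₂ : H) + r • (u e₃ : H) with hs
  have perp : ∀ z : Metric.sphere (0 : H) 1, ⟪(u e₁ : H), z⟫_ℂ = 0 → ⟪(u e₂ : H), z⟫_ℂ = 0 →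
      ⟪(u e₃ : H), z⟫_ℂ = 0 → ⟪(u x : H), z⟫_ℂ = 0 := by
    intro z h1 h2 h3
    obtain ⟨w, hw⟩ := h.surj_left z
    have t : ∀ y, ⟪(u y : H), z⟫_ℂ = 0 ↔ ⟪(y : H), w⟫_ℂ = 0 := by
      intro y
      rw [h.orth_left y w, ← norm_eq_zero, (SameLine.refl (u y)).norm_inner hw, norm_eq_zero]
    rw [t] at h1 h2 h3 ⊢
    rw [hx, inner_add_left, inner_add_left, inner_smul_left, inner_smul_left, inner_smul_left,
      h1, h2, h3]
    simp
  have hd : (u x : H) - s = 0 := by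
    by_contra h0
    have o1 : ⟪(u e₁ : H), (u x : H) - s⟫_ℂ = 0 := by
      simp only [hs, inner_sub_right, inner_add_right, inner_smul_right, n, k12, k13, ← hp]
      ring
    have o2 : ⟪(u e₂ : H), (u x : H) - s⟫_ℂ = 0 := by
      simp only [hs, inner_sub_right, inner_add_right, inner_smul_right, n, k21, k23, ← hq]
      ring
    have o3 : ⟪(u e₃ : H), (u x : H) - s⟫_ℂ = 0 := by
      simp only [hs, inner_sub_right, inner_add_right, inner_smul_right, n, k31, k32, ← hr]
      ring
    have hn := norm_ne_zero_iff.2 h0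
    have hk := perp ⟨((‖(u x : H) - s‖⁻¹ : ℝ) : ℂ) • ((u x : H) - s), by
      rw [mem_sphere_zero_iff_norm, norm_smul, Complex.norm_real, norm_inv, norm_norm,
        inv_mul_cancel₀ hn]⟩ (by simp only [inner_smul_right, o1, mul_zero])
      (by simp only [inner_smul_right, o2, mul_zero])
      (by simp only [inner_smul_right, o3, mul_zero])
    rw [inner_smul_right, mul_eq_zero, Complex.ofReal_eq_zero, inv_eq_zero] at hk
    have hk' := hk.resolve_left hn
    apply h0
    rw [← inner_self_eq_zero (𝕜 := ℂ)]
    conv_lhs => rw [inner_sub_left, hk']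
    rw [hs, inner_add_left, inner_add_left, inner_smul_left, inner_smul_left, inner_smul_left,
      ← hs, o1, o2, o3]
    simp
  have h1 := n (u x)
  have h2 : ⟪(u x : H), u x⟫_ℂ = ⟪s, (u x : H)⟫_ℂ := by rw [← sub_eq_zero.1 hd]
  rw [h2, hs, inner_add_left, inner_add_left, inner_smul_left, inner_smul_left, inner_smul_left,
    ← hp, ← hq, ← hr, Complex.conj_mul', Complex.conj_mul', Complex.conj_mul'] at h1
  exact_mod_cast h1

theorem norm_inner_left (hdim : 3 ≤ Module.rank ℂ H) (h : ActsBy φ u v)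
    (hφ : IsPIAutomorphism φ) (x x' : Metric.sphere (0 : H) 1) :
    ‖⟪(u x : H), u x'⟫_ℂ‖ = ‖⟪(x : H), x'⟫_ℂ‖ := by
  let m : Metric.sphere (0 : H) 1 × Metric.sphere (0 : H) 1 → ℝ := fun p =>
    ‖⟪(p.1 : H), p.2⟫_ℂ‖ ^ 2
  let m' : Metric.sphere (0 : H) 1 × Metric.sphere (0 : H) 1 → ℝ := fun p =>
    ‖⟪(u p.1 : H), u p.2⟫_ℂ‖ ^ 2
  have hfac : m'.FactorsThrough m := by
    intro p q hpq
    have h1 : ‖⟪(p.1 : H), p.2⟫_ℂ‖ = ‖⟪(q.1 : H), q.2⟫_ℂ‖ :=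
      (sq_eq_sq₀ (norm_nonneg _) (norm_nonneg _)).1 hpq
    -- The values of `u` at `p` and at `q` are both compared with the value of `v` at `q`.
    have h2 := (h.norm_inner_eq hφ h1).trans (h.norm_inner_eq hφ (x := q.1) (x' := q.2) rfl).symm
    simp only [m', h2]
  let k : ℝ → ℝ := Function.extend m m' 0
  have hk : ∀ p, k (m p) = m' p := fun p => hfac.extend_apply 0 p
  obtain ⟨e₁, -, -⟩ := exists_unit_orthogonal hdim (0 : H) 0
  obtain ⟨e₂, h12, -⟩ := exists_unit_orthogonal hdim (e₁ : H) 0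
  obtain ⟨e₃, h13, h23⟩ := exists_unit_orthogonal hdim (e₁ : H) e₂
  have h21 := inner_eq_zero_symm.1 h12
  have h31 := inner_eq_zero_symm.1 h13
  have h32 := inner_eq_zero_symm.1 h23
  have n : ∀ z : Metric.sphere (0 : H) 1, ⟪(z : H), z⟫_ℂ = 1 := fun z => by
    rw [inner_self_eq_norm_sq_to_K, norm_eq_of_mem_sphere z]; simp
  -- Square roots as coordinates in an orthonormal triple realize every admissible `(r, s, t)`.
  have real : ∀ r s t : ℝ, 0 ≤ r → 0 ≤ s → 0 ≤ t → r + s + t = 1 →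
      ∃ z : Metric.sphere (0 : H) 1, m (e₁, z) = r ∧ m (e₂, z) = s ∧ m (e₃, z) = t ∧
        m' (e₁, z) + m' (e₂, z) + m' (e₃, z) = 1 := by
    intro r s t hr hs ht hrst
    set w : H := ((√r : ℝ) : ℂ) • (e₁ : H) + ((√s : ℝ) : ℂ) • (e₂ : H) + ((√t : ℝ) : ℂ) • (e₃ : H)
      with hw
    have w1 : ⟪(e₁ : H), w⟫_ℂ = (√r : ℝ) := by
      simp [hw, h12, h13]
    have w2 : ⟪(e₂ : H), w⟫_ℂ = (√s : ℝ) := by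
      simp [hw, h21, h23]
    have w3 : ⟪(e₃ : H), w⟫_ℂ = (√t : ℝ) := by
      simp [hw, h31, h32]
    have hww : ⟪w, w⟫_ℂ = 1 := by
      conv_lhs => enter [2]; rw [hw]
      rw [inner_add_left, inner_add_left, inner_smul_left, inner_smul_left, inner_smul_left, w1, w2,
        w3, Complex.conj_ofReal, Complex.conj_ofReal, Complex.conj_ofReal, ← Complex.ofReal_mul,
        ← Complex.ofReal_mul, ← Complex.ofReal_mul, Real.mul_self_sqrt hr, Real.mul_self_sqrt hs,
        Real.mul_self_sqrt ht, ← Complex.ofReal_add, ← Complex.ofReal_add, hrst,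
        Complex.ofReal_one]
    have hnw : ‖w‖ = 1 := by
      rw [inner_self_eq_norm_sq_to_K] at hww
      have : ‖w‖ ^ 2 = 1 := Complex.ofReal_injective (by push_cast; exact hww)
      nlinarith [norm_nonneg w]
    refine ⟨⟨w, mem_sphere_zero_iff_norm.2 hnw⟩, ?_, ?_, ?_, h.sum_sq_eq_one h12 h13 h23 hw⟩
    · simp only [m, w1, Complex.norm_real, Real.norm_eq_abs, sq_abs, Real.sq_sqrt hr]
    · simp only [m, w2, Complex.norm_real, Real.norm_eq_abs, sq_abs, Real.sq_sqrt hs]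
    · simp only [m, w3, Complex.norm_real, Real.norm_eq_abs, sq_abs, Real.sq_sqrt ht]
  have k0 : k 0 = 0 := by
    have h1 := hk (e₁, e₂)
    have h2 : m (e₁, e₂) = 0 := by simp [m, h12]
    have h3 : m' (e₁, e₂) = 0 := by simp [m', (h.orth_left _ _).1 h12]
    rwa [h2, h3] at h1
  have knn : ∀ t, 0 ≤ t → t ≤ 1 → 0 ≤ k t := by
    intro t ht0 ht1
    obtain ⟨z, h1, -⟩ := real t (1 - t) 0 ht0 (by linarith) le_rfl (by ring)
    rw [← h1, hk]
    positivity
  have ksum : ∀ r s t, 0 ≤ r → 0 ≤ s → 0 ≤ t → r + s + t = 1 → k r + k s + k t = 1 := by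
    intro r s t hr hs ht hrst
    obtain ⟨z, h1, h2, h3, h4⟩ := real r s t hr hs ht hrst
    rw [← h1, ← h2, ← h3, hk, hk, hk, h4]
  have hle : ‖⟪(x : H), x'⟫_ℂ‖ ≤ 1 := by
    simpa using norm_inner_le_norm (𝕜 := ℂ) (x : H) x'
  have h1 := hk (x, x')
  rw [eq_id_of_sum_eq_one k0 knn ksum (by positivity)
    (pow_le_one₀ (norm_nonneg _) hle)] at h1
  exact ((sq_eq_sq₀ (norm_nonneg _) (norm_nonneg _)).1 h1).symm

theorem norm_inner_right (hdim : 3 ≤ Module.rank ℂ H) (h : ActsBy φ u v)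
    (hφ : IsPIAutomorphism φ) (y y' : Metric.sphere (0 : H) 1) :
    ‖⟪(v y : H), v y'⟫_ℂ‖ = ‖⟪(y : H), y'⟫_ℂ‖ := by
  rw [← h.norm_inner_eq hφ (x := y) (x' := y') rfl, h.norm_inner_left hdim hφ]

end ActsBy

end Automorphisms

/-! ### Constancy of the phase and passage from atoms to all partial isometries. -/

section Conclusion

open InnerProductSpace

open scoped InnerProductSpace

variable {H : Type*} [NormedAddCommGroup H] [InnerProductSpace ℂ H]

/-- A semilinear isometric equivalence followed by multiplication with a unimodular scalar. -/
noncomputable def LinearIsometryEquiv.unimodularSMul {σ σ' : ℂ →+* ℂ} [RingHomInvPair σ σ']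
    [RingHomInvPair σ' σ] (L : H ≃ₛₗᵢ[σ] H) (c : ℂ) (hc : ‖c‖ = 1) : H ≃ₛₗᵢ[σ] H :=
  L.trans ⟨LinearEquiv.smulOfNeZero ℂ H c (norm_ne_zero_iff.1 (hc ▸ one_ne_zero)), fun x => by
    simp [norm_smul, hc]⟩

theorem LinearIsometryEquiv.unimodularSMul_apply {σ σ' : ℂ →+* ℂ} [RingHomInvPair σ σ']
    [RingHomInvPair σ' σ] (L : H ≃ₛₗᵢ[σ] H) (c : ℂ) (hc : ‖c‖ = 1) (x : H) :
    L.unimodularSMul c hc x = c • L x := rfl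

variable [CompleteSpace H]

namespace IsPIAutomorphism

variable {φ : PI H → PI H}

variable {σ σ' τ τ' : ℂ →+* ℂ} [RingHomInvPair σ σ'] [RingHomInvPair σ' σ] [RingHomInvPair τ τ']
  [RingHomInvPair τ' τ]

/-- For `W` carrying `y₁, y₂` to `x₁, x₂`, the vector `φ W (M (a y₁ + b y₂))` is computed by
semilinearity and from the atom at the combined unit vectors, whose coefficient is `γ`. Components
along `L x₁` and `L x₂` are then compared. -/
theorem coeff_relation (hφ : IsPIAutomorphism φ) {L : H ≃ₛₗᵢ[σ] H} {M : H ≃ₛₗᵢ[τ] H}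
    {g : Metric.sphere (0 : H) 1 → Metric.sphere (0 : H) 1 → ℂ} (hg : ∀ x y, ‖g x y‖ = 1)
    (hgφ : ∀ x y, (φ (atom x y)).1 = g x y • rankOne ℂ (L x) (M y))
    {x₁ x₂ y₁ y₂ : Metric.sphere (0 : H) 1} (hx : ⟪(x₁ : H), x₂⟫_ℂ = 0)
    (hy : ⟪(y₁ : H), y₂⟫_ℂ = 0) {a b : ℂ} (hab : ‖a‖ ^ 2 + ‖b‖ ^ 2 = 1) :
    ∃ γ : ℂ, τ a * g x₁ y₁ = γ * σ a ∧ τ b * g x₂ y₂ = γ * σ b := by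
  have hx' := inner_eq_zero_symm.1 hx
  have hy' := inner_eq_zero_symm.1 hy
  have unit : ∀ z₁ z₂ : Metric.sphere (0 : H) 1, ⟪(z₁ : H), z₂⟫_ℂ = 0 →
      a • (z₁ : H) + b • (z₂ : H) ∈ Metric.sphere (0 : H) 1 := by
    intro z₁ z₂ hz
    have h := norm_add_sq_eq_norm_sq_add_norm_sq_of_inner_eq_zero (𝕜 := ℂ) (a • (z₁ : H))
      (b • (z₂ : H)) (by rw [inner_smul_left, inner_smul_right, hz, mul_zero, mul_zero])
    rw [norm_smul, norm_smul, norm_eq_of_mem_sphere, norm_eq_of_mem_sphere] at h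
    rw [mem_sphere_zero_iff_norm]
    nlinarith [norm_nonneg (a • (z₁ : H) + b • (z₂ : H))]
  have apply : ∀ (W : PI H) (x y : Metric.sphere (0 : H) 1), W.1 y = x →
      (φ W).1 (M y) = g x y • L x := fun W x y hW =>
    hφ.map_apply_of_map_atom (hg x y) (by simp) (by simp) (hgφ x y) hW
  let W : PI H := ⟨rankOne ℂ (x₁ : H) (y₁ : H) + rankOne ℂ (x₂ : H) (y₂ : H),
    isPartialIsometry_rankOne_add_rankOne (norm_eq_of_mem_sphere _) (norm_eq_of_mem_sphere _)
      (norm_eq_of_mem_sphere _) (norm_eq_of_mem_sphere _) hx hy⟩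
  have hW : ∀ z : H, W.1 z = ⟪(y₁ : H), z⟫_ℂ • (x₁ : H) + ⟪(y₂ : H), z⟫_ℂ • (x₂ : H) :=
    fun z => rfl
  have hW1 : W.1 y₁ = x₁ := by simp [hW, hy']
  have hW2 : W.1 y₂ = x₂ := by simp [hW, hy]
  have h1 := apply W x₁ y₁ hW1
  have h2 := apply W x₂ y₂ hW2
  have h3 := apply W ⟨_, unit x₁ x₂ hx⟩ ⟨_, unit y₁ y₂ hy⟩ (by
    rw [map_add, map_smul, map_smul, hW1, hW2])
  refine ⟨g ⟨_, unit x₁ x₂ hx⟩ ⟨_, unit y₁ y₂ hy⟩, ?_⟩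
  generalize g ⟨_, unit x₁ x₂ hx⟩ ⟨_, unit y₁ y₂ hy⟩ = γ at h3
  simp only [map_add, map_smulₛₗ, h1, h2, RingHom.id_apply] at h3
  have n : ∀ z : Metric.sphere (0 : H) 1, ⟪L (z : H), L z⟫_ℂ = 1 := fun z => by
    rw [inner_self_eq_norm_sq_to_K, L.norm_map, norm_eq_of_mem_sphere z]; simp
  have k12 := L.inner_map_eq_zero hx
  have k21 := L.inner_map_eq_zero hx'
  have e1 := congrArg (fun z => ⟪L (x₁ : H), z⟫_ℂ) h3
  have e2 := congrArg (fun z => ⟪L (x₂ : H), z⟫_ℂ) h3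
  simp only [inner_add_right, inner_smul_right, n, k12, k21, mul_zero, mul_one, add_zero,
    zero_add] at e1 e2
  exact ⟨e1, e2⟩

theorem coeff_const (hdim : 3 ≤ Module.rank ℂ H) (hφ : IsPIAutomorphism φ)
    {L : H ≃ₛₗᵢ[σ] H} {M : H ≃ₛₗᵢ[τ] H} (hσ : ∀ r : ℝ, σ r = r) (hτ : ∀ r : ℝ, τ r = r)
    {g : Metric.sphere (0 : H) 1 → Metric.sphere (0 : H) 1 → ℂ} (hg : ∀ x y, ‖g x y‖ = 1)
    (hgφ : ∀ x y, (φ (atom x y)).1 = g x y • rankOne ℂ (L x) (M y)) :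
    (∃ c : ℂ, ‖c‖ = 1 ∧ ∀ x y, g x y = c) ∧ σ Complex.I = τ Complex.I := by
  set r : ℂ := ((√(1 / 2) : ℝ) : ℂ) with hr
  have hrn : ‖r‖ ^ 2 = 1 / 2 := by
    rw [hr, Complex.norm_real, Real.norm_eq_abs, sq_abs, Real.sq_sqrt (by norm_num)]
  have hr0 : r ≠ 0 := by
    intro h
    rw [h] at hrn
    norm_num at hrn
  have orth : ∀ x₁ x₂ y₁ y₂ : Metric.sphere (0 : H) 1, ⟪(x₁ : H), x₂⟫_ℂ = 0 →
      ⟪(y₁ : H), y₂⟫_ℂ = 0 → g x₁ y₁ = g x₂ y₂ := by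
    intro x₁ x₂ y₁ y₂ hx hy
    obtain ⟨γ, h1, h2⟩ := hφ.coeff_relation hg hgφ hx hy (a := r) (b := r)
      (by rw [hrn]; norm_num)
    rw [hσ, hτ] at h1 h2
    exact mul_left_cancel₀ hr0 (h1.trans h2.symm)
  obtain ⟨o, -, -⟩ := exists_unit_orthogonal hdim (0 : H) 0
  refine ⟨⟨g o o, hg o o, fun x y => ?_⟩, ?_⟩
  · obtain ⟨z, hz, hz'⟩ := exists_unit_orthogonal hdim (x : H) o
    obtain ⟨w, hw, hw'⟩ := exists_unit_orthogonal hdim (y : H) o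
    rw [orth x z y w hz hw, orth o z o w hz' hw']
  · obtain ⟨z, hz, -⟩ := exists_unit_orthogonal hdim (o : H) 0
    -- A non-real ratio of coefficients compares `σ` and `τ` at `I`.
    obtain ⟨γ, h1, h2⟩ := hφ.coeff_relation hg hgφ hz hz (a := r * Complex.I) (b := r)
      (by rw [norm_mul, Complex.norm_I, mul_one, hrn]; norm_num)
    rw [map_mul, map_mul, hσ, hτ] at h1
    rw [hσ, hτ, mul_comm] at h2
    have h3 := mul_right_cancel₀ hr0 h2
    rw [← h3, ← orth o z o z hz hz] at h1
    have hg0 : g o o ≠ 0 := by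
      rw [← norm_ne_zero_iff, hg]
      exact one_ne_zero
    have h4 : (r * g o o) * τ Complex.I = (r * g o o) * σ Complex.I := by
      rw [← hr] at h1
      linear_combination h1
    exact (mul_left_cancel₀ (mul_ne_zero hr0 hg0) h4).symm

theorem apply_of_map_atom (hφ : IsPIAutomorphism φ) {U M : H ≃ₛₗᵢ[σ] H}
    (h : ∀ x y : Metric.sphere (0 : H) 1, (φ (atom x y)).1 = rankOne ℂ (U x) (M y)) (R : PI H)
    (y : H) : (φ R).1 (M y) = U (R.1 y) := by
  have unit : ∀ x : H, x ≠ 0 → ((‖x‖⁻¹ : ℝ) : ℂ) • x ∈ Metric.sphere (0 : H) 1 := by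
    intro x hx
    rw [mem_sphere_zero_iff_norm, norm_smul, Complex.norm_real, norm_inv, norm_norm,
      inv_mul_cancel₀ (norm_ne_zero_iff.2 hx)]
  have smul_mem : ∀ (r : ℂ) (z : H), (φ R).1 (M z) = U (R.1 z) →
      (φ R).1 (M (r • z)) = U (R.1 (r • z)) := by
    intro r z hz
    rw [M.map_smulₛₗ, (φ R).1.map_smul, hz, R.1.map_smul, U.map_smulₛₗ]
  have on_init : ∀ y ∈ initialSpace R.1, (φ R).1 (M y) = U (R.1 y) := by
    intro y hy
    rcases eq_or_ne y 0 with rfl | hy0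
    · simp
    let z : Metric.sphere (0 : H) 1 := ⟨_, unit y hy0⟩
    have hyz : y = (‖y‖ : ℂ) • (z : H) := by
      change y = (‖y‖ : ℂ) • ((‖y‖⁻¹ : ℝ) : ℂ) • y
      rw [smul_smul, ← Complex.ofReal_mul, mul_inv_cancel₀ (norm_ne_zero_iff.2 hy0),
        Complex.ofReal_one, one_smul]
    have hz : (z : H) ∈ initialSpace R.1 := Submodule.smul_mem _ _ hy
    have h1 := hφ.map_apply_of_map_atom (f := 1) (x := R.applyUnit z hz) (y := z) (W := R)
      (a := U (R.applyUnit z hz : H)) (b := M z)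
      norm_one (by simp) (by simp) (by rw [h, one_smul]) rfl
    rw [one_smul] at h1
    rw [hyz]
    exact smul_mem _ _ h1
  -- Atoms below `φ R` are pulled back to atoms below `R`. This bounds the initial space of `φ R`
  -- from above, so that `φ R` vanishes where the formula requires it.
  have init_sub : ∀ w ∈ initialSpace (φ R).1, M.symm w ∈ initialSpace R.1 := by
    intro w hw
    rcases eq_or_ne w 0 with rfl | hw0
    · simp
    let z : Metric.sphere (0 : H) 1 := ⟨_, unit w hw0⟩
    have hz : (z : H) ∈ initialSpace (φ R).1 := Submodule.smul_mem _ _ hw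
    have hle := atom_applyUnit_le (φ R) z hz
    let y : Metric.sphere (0 : H) 1 := ⟨M.symm z, by simp⟩
    let x : Metric.sphere (0 : H) 1 := ⟨U.symm ((φ R).applyUnit z hz), by simp⟩
    have hxy : φ (atom x y) = atom ((φ R).applyUnit z hz) z := by
      apply Subtype.ext
      rw [h]
      simp [x, y, atom]
    rw [← hxy, ← hφ.le_iff] at hle
    have h1 := mem_initialSpace_of_atom_le hle
    have h2 : M.symm w = σ' (‖w‖ : ℂ) • (y : H) := by
      rw [← map_smulₛₗ]
      change M.symm w = M.symm ((‖w‖ : ℂ) • ((‖w‖⁻¹ : ℝ) : ℂ) • w)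
      rw [smul_smul, ← Complex.ofReal_mul, mul_inv_cancel₀ (norm_ne_zero_iff.2 hw0),
        Complex.ofReal_one, one_smul]
    rw [h2]
    exact Submodule.smul_mem _ _ h1
  have : CompleteSpace (initialSpace R.1) :=
    (Submodule.isClosed_orthogonal _).completeSpace_coe
  obtain ⟨a, ha, b, hb, rfl⟩ := (initialSpace R.1).exists_add_mem_mem_orthogonal y
  have hMb : M b ∈ (initialSpace (φ R).1)ᗮ := by
    intro w hw
    have := M.inner_map_eq_zero (hb _ (init_sub w hw))
    rwa [M.apply_symm_apply] at this
  rw [mem_orthogonal_initialSpace_iff] at hb hMb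
  rw [map_add, map_add, map_add, map_add, on_init a ha, hb, hMb, _root_.map_zero]

theorem exists_representation (hφ : IsPIAutomorphism φ) {L M : H ≃ₛₗᵢ[σ] H} {c : ℂ}
    (hc : ‖c‖ = 1) (h : ∀ x y : Metric.sphere (0 : H) 1,
      (φ (atom x y)).1 = c • rankOne ℂ (L x) (M y)) :
    ∃ (U : H ≃ₛₗᵢ[σ] H) (V : H ≃ₛₗᵢ[σ'] H), ∀ (R : PI H) (x : H),
      (φ R).1 x = U (R.1 (V x)) := by
  refine ⟨L.unimodularSMul c hc, M.symm, fun R x => ?_⟩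
  rw [← hφ.apply_of_map_atom (M := M) (fun x y => ?_), M.apply_symm_apply]
  rw [h, L.unimodularSMul_apply, map_smul]
  rfl

end IsPIAutomorphism

theorem ActsBy.exists_coeff {φ : PI H → PI H}
    {u v : Metric.sphere (0 : H) 1 → Metric.sphere (0 : H) 1} (h : ActsBy φ u v) {L M : H → H}
    (hL : ∀ x, ∃ c : ℂ, ‖c‖ = 1 ∧ (u x : H) = c • L x)
    (hM : ∀ x, ∃ c : ℂ, ‖c‖ = 1 ∧ (v x : H) = c • M x) :
    ∃ g : Metric.sphere (0 : H) 1 → Metric.sphere (0 : H) 1 → ℂ, (∀ x y, ‖g x y‖ = 1) ∧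
      ∀ x y, (φ (atom x y)).1 = g x y • rankOne ℂ (L x) (M y) := by
  have : ∀ x y, ∃ c : ℂ, ‖c‖ = 1 ∧ (φ (atom x y)).1 = c • rankOne ℂ (L x) (M y) := by
    intro x y
    obtain ⟨f, hf, hfa⟩ := h.map_atom x y
    obtain ⟨c, hc, hcx⟩ := hL x
    obtain ⟨d, hd, hdy⟩ := hM y
    refine ⟨f * (c * starRingEnd ℂ d), by simp [hf, hc, hd], ?_⟩
    rw [hfa, hcx, hdy]
    ext w
    simp only [rankOne_apply, inner_smul_left, smul_apply, smul_smul]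
    congr 1
    ring
  choose g hg hgφ using this
  exact ⟨g, hg, hgφ⟩

/-- An automorphism acting coordinatewise on rank-one partial isometries is a two-sided
multiplication. Order and orthogonality alone force this; no continuity is needed. -/
theorem ActsBy.exists_representation (hdim : 3 ≤ Module.rank ℂ H) {φ : PI H → PI H}
    {u v : Metric.sphere (0 : H) 1 → Metric.sphere (0 : H) 1} (h : ActsBy φ u v)
    (hφ : IsPIAutomorphism φ) :
    (∃ U V : H ≃ₗᵢ[ℂ] H, ∀ (R : PI H) (x : H), (φ R).1 x = U (R.1 (V x))) ∨
    (∃ U V : H ≃ₗᵢ⋆[ℂ] H, ∀ (R : PI H) (x : H), (φ R).1 x = U (R.1 (V x))) := by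
  obtain ⟨e, -, -⟩ := exists_unit_orthogonal hdim (0 : H) 0
  have he := norm_eq_of_mem_sphere e
  have hid : ∀ r : ℝ, RingHom.id ℂ (r : ℂ) = r := fun r => rfl
  have hstar : ∀ r : ℝ, starRingEnd ℂ (r : ℂ) = r := Complex.conj_ofReal
  have hne : RingHom.id ℂ Complex.I ≠ starRingEnd ℂ Complex.I := by
    intro hI
    have := congrArg Complex.im hI
    norm_num at this
  rcases exists_isometry_of_norm_inner he (h.norm_inner_left hdim hφ) h.surj_left with
    ⟨L, hL⟩ | ⟨L, hL⟩ <;>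
  rcases exists_isometry_of_norm_inner he (h.norm_inner_right hdim hφ) h.surj_right with
    ⟨M, hM⟩ | ⟨M, hM⟩ <;>
  obtain ⟨g, hg, hgφ⟩ := h.exists_coeff hL hM
  · obtain ⟨⟨c, hc, hgc⟩, -⟩ := hφ.coeff_const hdim hid hid hg hgφ
    exact Or.inl (hφ.exists_representation hc fun x y => by rw [hgφ, hgc])
  · exact absurd (hφ.coeff_const hdim hid hstar hg hgφ).2 hne
  · exact absurd (hφ.coeff_const hdim hstar hid hg hgφ).2 hne.symm
  · obtain ⟨⟨c, hc, hgc⟩, -⟩ := hφ.coeff_const hdim hstar hstar hg hgφ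
    exact Or.inr (hφ.exists_representation hc fun x y => by rw [hgφ, hgc])

end Conclusion

theorem theorem1 {H : Type*} [NormedAddCommGroup H] [InnerProductSpace ℂ H] [CompleteSpace H]
    (hdim : 3 ≤ Module.rank ℂ H)
    (φ : PI H → PI H) (hbij : Function.Bijective φ)
    (hle : ∀ P Q : PI H, PILe P Q ↔ PILe (φ P) (φ Q))
    (horth : ∀ P Q : PI H, PIOrthogonal P Q ↔ PIOrthogonal (φ P) (φ Q))
    (hcont : ∃ R₀ : PI H, (R₀ : H →L[ℂ] H) ≠ 0 ∧ ContinuousAt φ R₀) :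
    (∃ U V : H ≃ₗᵢ[ℂ] H, ∀ (R : PI H) (x : H), (φ R).1 x = U (R.1 (V x))) ∨
    (∃ U V : H ≃ₗᵢ⋆[ℂ] H, ∀ (R : PI H) (x : H), (φ R).1 x = U (R.1 (V x))) ∨
    (∃ U V : H ≃ₗᵢ[ℂ] H, ∀ (R : PI H) (x : H), (φ R).1 x = U (adjoint R.1 (V x))) ∨
    (∃ U V : H ≃ₗᵢ⋆[ℂ] H, ∀ (R : PI H) (x : H), (φ R).1 x = U (adjoint R.1 (V x))) := by
  have hφ : IsPIAutomorphism φ := ⟨hbij, hle, horth⟩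
  obtain ⟨u, v, h | h⟩ := hφ.exists_actsBy hdim
  · rcases h.exists_representation hdim hφ with h | h
    · exact Or.inl h
    · exact Or.inr (Or.inl h)
  · rcases h.exists_representation hdim hφ.comp_adjointPI with ⟨U, V, h⟩ | ⟨U, V, h⟩
    · refine Or.inr (Or.inr (Or.inl ⟨U, V, fun R x => ?_⟩))
      have := h (adjointPI R) x
      rwa [adjointPI_adjointPI] at this
    · refine Or.inr (Or.inr (Or.inr ⟨U, V, fun R x => ?_⟩))
      have := h (adjointPI R) x
      rwa [adjointPI_adjointPI] at this
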